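/- Let $G$ be a finite group, let $\pi(G)$ denote the set of prime divisors of $|G|$, and let $\sigma$ be a partition of the set of all primes (or, more generally, of any set of primes containing $\pi(G)$; in particular of $\pi(G)$ itself). For a subgroup $H\le G$ write $H^G$ for the smallest normal subgroup of $G$ containing $H$ and $H_G$ for the greatest normal subgroup of $G$ contained in $H$. For a set $\pi$ of primes, $O_\pi(X)$ is the greatest normal $\pi$-subgroup of a finite group $X$ and $O^\pi(X)$ is the smallest normal subgroup of $X$ whose index is a $\pi$-number. A finite group is $\sigma$-nilpotent if it has a normal Hall $\sigma_i$-subgroup for every $\sigma_i\in\sigma$. A subgroup $K\le G$ is a $\mathfrak G_\pi$-projector of $G$ if $KN/N$ is maximal among the $\pi$-subgroups of $G/N$ for every $N\trianglelefteq G$. A subgroup $H\le G$ is $\sigma$-$p$-permutable in $G$ if for every $\sigma_i\in\sigma$ there is a $\mathfrak G_{\sigma_i}$-projector $K$ of $G$ with $HK^x=K^xH$ for all $x\in G$, where $K^x=x^{-1}Kx$. Theorem 6. A subgroup $H$ of $G$ is $\sigma$-$p$-permutable in $G$ if and only if 1. $H^G/H_G$ is $\sigma$-nilpotent, and 2. for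 every $\sigma_i\in\sigma$ that contains a prime divisor of $|H/H_G|$, $O(\sigma_i)^{O^{\sigma_i}(G)}=O(\sigma_i)$, where $O(\sigma_i)$ is the subgroup with $H_G\le O(\sigma_i)\le H$ and $O(\sigma_i)/H_G=O_{\sigma_i}(H/H_G)$, and $X^Y$ denotes $\langle y^{-1}xy \mid x\in X,\ y\in Y\rangle$ (that is, $O(\sigma_i)$ is normalized by $O^{\sigma_i}(G)$). -/

import Mathlib

open scoped Pointwise

namespace SigmaGroup

/-- `σ` is a partition of the set `S`: its members are nonempty, pairwise disjoint, and their
union is `S`. -/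
def IsPartitionOf (σ : Set (Set ℕ)) (S : Set ℕ) : Prop :=
  ∅ ∉ σ ∧ σ.PairwiseDisjoint id ∧ ⋃₀ σ = S

/-- `π(G)`: the set of prime divisors of the order of the (finite) group `G`. -/
def primeDivisors (G : Type*) [Group G] : Set ℕ :=
  {p | p.Prime ∧ p ∣ Nat.card G}

/-- `n` is a `π`-number: all its prime divisors lie in `π`. -/
def IsPiNumber (π : Set ℕ) (n : ℕ) : Prop :=
  ∀ p : ℕ, p.Prime → p ∣ n → p ∈ π

/-- `G` is a `π`-group: its order is a `π`-number. -/
def IsPiGroup (π : Set ℕ) (G : Type*) [Group G] : Prop :=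
  IsPiNumber π (Nat.card G)

/-- `K` is a Hall `π`-subgroup: a `π`-subgroup whose index is a `π'`-number. -/
def IsHallSubgroup {G : Type*} [Group G] (π : Set ℕ) (K : Subgroup G) : Prop :=
  IsPiGroup π K ∧ IsPiNumber πᶜ K.index

/-- `G` is `σ`-nilpotent: it has a normal Hall `σᵢ`-subgroup for every `σᵢ ∈ σ`. -/
def IsSigmaNilpotent (σ : Set (Set ℕ)) (G : Type*) [Group G] : Prop :=
  ∀ s ∈ σ, ∃ K : Subgroup G, K.Normal ∧ IsHallSubgroup s K

/-- `K` is a projector of `G` for the class of all `π`-groups: for every `N ⊴ G`, the image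
`KN/N` is maximal among the `π`-subgroups of `G/N`. -/
def IsPiProjector {G : Type*} [Group G] (π : Set ℕ) (K : Subgroup G) : Prop :=
  ∀ (N : Subgroup G) [N.Normal],
    Maximal (fun L : Subgroup (G ⧸ N) => IsPiGroup π L) (K.map (QuotientGroup.mk' N))

/-- The conjugate subgroup `K ^ x = x⁻¹ K x`. -/
def conjSubgroup {G : Type*} [Group G] (K : Subgroup G) (x : G) : Subgroup G :=
  K.map (MulAut.conj x⁻¹).toMonoidHom

/-- `H` is `σ`-`p`-permutable in `G`: for every `σᵢ ∈ σ` there is a projector `K` of `G` for the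
class of `σᵢ`-groups such that `H K^x = K^x H` (as sets of products) for all `x ∈ G`. -/
def IsSigmaPPermutable {G : Type*} [Group G] (σ : Set (Set ℕ)) (H : Subgroup G) : Prop :=
  ∀ s ∈ σ, ∃ K : Subgroup G, IsPiProjector s K ∧
    ∀ x : G, (H : Set G) * (conjSubgroup K x : Set G) = (conjSubgroup K x : Set G) * (H : Set G)

/-- `O_π(G)`: the greatest normal `π`-subgroup, as the join of all normal `π`-subgroups. -/
def piCore (π : Set ℕ) (G : Type*) [Group G] : Subgroup G :=
  sSup {N : Subgroup G | N.Normal ∧ IsPiGroup π N}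

/-- `O^π(G)`: the smallest normal subgroup of `π`-index, as the intersection of all normal
subgroups whose index is a `π`-number. -/
def piResidual (π : Set ℕ) (G : Type*) [Group G] : Subgroup G :=
  sInf {N : Subgroup G | N.Normal ∧ IsPiNumber π N.index}

/-- `X ^ Y = ⟨x ^ y | x ∈ X, y ∈ Y⟩` for subgroups `X` and `Y` of `G`. -/
def conjClosure {G : Type*} [Group G] (X Y : Subgroup G) : Subgroup G :=
  Subgroup.closure {g | ∃ x ∈ X, ∃ y ∈ Y, g = y⁻¹ * x * y}

/-- The section `H / K` for `K ⊴ G`, where `K ∩ H` is divided out; it is only used for `K ≤ H`. -/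
abbrev Section {G : Type*} [Group G] (H K : Subgroup G) [K.Normal] : Type _ :=
  H ⧸ K.subgroupOf H

/-- The subgroup `O(π)` of `G` with `H_G ≤ O(π) ≤ H` and `O(π) / H_G = O_π(H / H_G)`, where `H_G`
is the normal core of `H` in `G`. -/
def coreSectionPreimage {G : Type*} [Group G] (π : Set ℕ) (H : Subgroup G) : Subgroup G :=
  ((piCore π (Section H H.normalCore)).comap
    (QuotientGroup.mk' (H.normalCore.subgroupOf H))).map H.subtype

end SigmaGroup

namespace SigmaGroup

open Subgroup

/-! ### Arithmetic of `π`-numbers. -/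

section Numbers

/-! Write C for the core H_G and Y for the closure H^G. The basic mechanism is a clash of indices
(`Permutes.mem_normalizer`). Let E permute with all conjugates of the projectors K_t, and let M be
normal with |M : E ∩ M| an s-number. For t ≠ s and a conjugate L of K_t, the index of E in M ∩ EL is
both an s-number and a t-number, so E ∩ M = M ∩ EL is normalized by L. Hence E ∩ M is normalized by
every s'-element of G, and these generate O^s(G). Applied to the normal subgroup A inducing the Hall
s-subgroup of Y/C, this gives condition 2, because O(s) = H ∩ A.

The σ-nilpotency of Y/C is proved by induction from larger to smaller H. Let N/C be a minimal normal
subgroup of G/C, and let M be the core of HN, so that (HN)^G/M is σ-nilpotent. By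
`Permutes.inf_normalClosure_le_or`, either N ∩ Y ≤ C, and then M ∩ Y = C and the property restricts
to Y, or N/C is an s-group, and then so is M/C. In the latter case T = O^s(H) equals O^s(HM) and is
normalized by all s-elements, while H ∩ M is normalized by all s'-elements. As G is the product of
the two normalizers, [M, T] ≤ C, so D = T^G centralizes M/C. A central Hall subgroup of a group with
no nontrivial s-quotient is trivial, so M ∩ D ≤ C. Thus Y/C is a subdirect product of σ-nilpotent
groups, namely Y/(M ∩ Y) and the s-group Y/DC.

Conversely, projectors always exist (`exists_isPiProjector`), and any choice of them works. Modulo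
C, H is generated by its intersections with the Hall subgroups of Y/C. A conjugate of K_s normalizes
those for t ≠ s and covers the one for s, so it permutes with H (`permutes_of_normalizer`). -/

theorem IsPiNumber.of_dvd {π : Set ℕ} {m n : ℕ} (h : IsPiNumber π n) (hd : m ∣ n) :
    IsPiNumber π m :=
  fun p hp hpm => h p hp (hpm.trans hd)

theorem IsPiNumber.mono {π ρ : Set ℕ} {n : ℕ} (h : IsPiNumber π n) (hs : π ⊆ ρ) :
    IsPiNumber ρ n :=
  fun p hp hpn => hs (h p hp hpn)

theorem IsPiNumber.mul {π : Set ℕ} {m n : ℕ} (hm : IsPiNumber π m) (hn : IsPiNumber π n) :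
    IsPiNumber π (m * n) :=
  fun p hp hpmn => (hp.dvd_mul.mp hpmn).elim (hm p hp) (hn p hp)

theorem isPiNumber_one (π : Set ℕ) : IsPiNumber π 1 :=
  fun _ hp h1 => absurd (Nat.dvd_one.mp h1) hp.ne_one

theorem IsPiNumber.eq_one {π : Set ℕ} {n : ℕ} (h : IsPiNumber π n) (h' : IsPiNumber πᶜ n) :
    n = 1 := by
  by_contra hn
  obtain ⟨p, hp, hpn⟩ := Nat.exists_prime_and_dvd hn
  exact h' p hp hpn (h p hp hpn)

theorem IsPiNumber.coprime {π : Set ℕ} {m n : ℕ} (h : IsPiNumber π m) (h' : IsPiNumber πᶜ n) :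
    m.Coprime n :=
  (h.of_dvd (Nat.gcd_dvd_left m n)).eq_one (h'.of_dvd (Nat.gcd_dvd_right m n))

end Numbers

/-! ### Permuting subgroups and indices. -/

section Permuting

variable {G : Type*} [Group G]

theorem coe_sup_of_mul_comm {H K : Subgroup G} (h : (H : Set G) * K = K * H) :
    ((H ⊔ K : Subgroup G) : Set G) = H * K := by
  apply Set.Subset.antisymm
  · let L : Subgroup G :=
      { carrier := (H : Set G) * K
        one_mem' := ⟨1, H.one_mem, 1, K.one_mem, by simp⟩
        mul_mem' := by
          intro a b ha hb
          have : a * b ∈ ((H : Set G) * K) * ((H : Set G) * K) := Set.mul_mem_mul ha hb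
          have e : ((H : Set G) * K) * ((H : Set G) * K) = (H : Set G) * K := by
            rw [mul_assoc, ← mul_assoc (K : Set G), ← h, mul_assoc (H : Set G), coe_mul_coe,
              ← mul_assoc, coe_mul_coe]
          rwa [e] at this
        inv_mem' := by
          rintro a ⟨x, hx, k, hk, rfl⟩
          rw [h]
          exact ⟨k⁻¹, K.inv_mem hk, x⁻¹, H.inv_mem hx, by simp⟩ }
    have : H ⊔ K ≤ L := sup_le (fun x hx => ⟨x, hx, 1, K.one_mem, by simp⟩)
      (fun x hx => ⟨1, H.one_mem, x, hx, by simp⟩)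
    exact this
  · rintro _ ⟨x, hx, k, hk, rfl⟩
    exact mul_mem_sup hx hk

theorem mul_comm_of_forall {H K : Subgroup G}
    (h : ∀ k ∈ K, ∀ x ∈ H, k * x ∈ (H : Set G) * (K : Set G)) :
    (H : Set G) * K = K * H := by
  apply Set.Subset.antisymm
  · rintro _ ⟨x, hx, k, hk, rfl⟩
    obtain ⟨y, hy, l, hl, e⟩ := h k⁻¹ (K.inv_mem hk) x⁻¹ (H.inv_mem hx)
    refine ⟨l⁻¹, K.inv_mem hl, y⁻¹, H.inv_mem hy, ?_⟩
    have := congrArg (·⁻¹) e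
    simpa using this
  · rintro _ ⟨k, hk, x, hx, rfl⟩
    exact h k hk x hx

theorem mul_comm_of_le_normalizer {H K : Subgroup G} (h : K ≤ normalizer (H : Set G)) :
    (H : Set G) * K = K * H :=
  mul_comm_of_forall fun k hk x hx =>
    ⟨k * x * k⁻¹, le_normalizer_iff.mp h k hk x hx, k, hk, by simp⟩

theorem relIndex_sup_of_mul_comm {H K : Subgroup G} (h : (H : Set G) * K = K * H) :
    H.relIndex (H ⊔ K) = H.relIndex K := by
  symm
  have hle : K ≤ H ⊔ K := le_sup_right
  refine Nat.card_congr (Equiv.ofBijective (quotientSubgroupOfEmbeddingOfLE H hle)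
    ⟨(quotientSubgroupOfEmbeddingOfLE H hle).injective, ?_⟩)
  intro q
  obtain ⟨⟨g, hg⟩, rfl⟩ := QuotientGroup.mk_surjective q
  have hg' : g ∈ (K : Set G) * H := by
    rw [← h, ← coe_sup_of_mul_comm h]; exact hg
  obtain ⟨k, hk, x, hx, rfl⟩ := hg'
  refine ⟨QuotientGroup.mk ⟨k, hk⟩, ?_⟩
  rw [quotientSubgroupOfEmbeddingOfLE_apply_mk, QuotientGroup.eq, mem_subgroupOf]
  simpa using hx

theorem relIndex_sup_normal (H M : Subgroup G) [M.Normal] : H.relIndex (H ⊔ M) = H.relIndex M :=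
  relIndex_sup_of_mul_comm (set_mul_normal_comm _ _)

/-- H normalizes M ∩ J, so the left index is that of H in the subgroup H(M ∩ J) of J. -/
theorem relIndex_normal_inf_dvd {H J : Subgroup G} (M : Subgroup G) [M.Normal] (h : H ≤ J) :
    H.relIndex (M ⊓ J) ∣ H.relIndex J := by
  have hc : (H : Set G) * ((M ⊓ J : Subgroup G) : Set G) = ((M ⊓ J : Subgroup G) : Set G) * H := by
    refine (mul_comm_of_le_normalizer ?_).symm
    rw [le_normalizer_iff]
    rintro x hx y ⟨hyM, hyJ⟩
    exact ⟨‹M.Normal›.conj_mem y hyM x, J.mul_mem (J.mul_mem (h hx) hyJ) (J.inv_mem (h hx))⟩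
  rw [← relIndex_sup_of_mul_comm hc]
  exact ⟨_, (relIndex_mul_relIndex _ _ _ le_sup_left (sup_le h inf_le_right)).symm⟩

theorem relIndex_dvd_relIndex_of_le_right {H K L : Subgroup G} (hHK : H ≤ K) (hKL : K ≤ L) :
    H.relIndex K ∣ H.relIndex L :=
  ⟨_, (relIndex_mul_relIndex _ _ _ hHK hKL).symm⟩

end Permuting

/-! ### The residual O^π as the subgroup generated by π'-elements. -/

section Residual

variable {G : Type*} [Group G]

/-- The subgroup generated by the elements of `M` whose order is prime to `π`. -/
def elementResidual (π : Set ℕ) (M : Subgroup G) : Subgroup G :=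
  closure {g | g ∈ M ∧ IsPiNumber πᶜ (orderOf g)}

theorem elementResidual_le (π : Set ℕ) (M : Subgroup G) : elementResidual π M ≤ M :=
  (closure_le _).mpr fun _ hg => hg.1

theorem mem_elementResidual {π : Set ℕ} {M : Subgroup G} {g : G} (hg : g ∈ M)
    (ho : IsPiNumber πᶜ (orderOf g)) : g ∈ elementResidual π M :=
  subset_closure ⟨hg, ho⟩

theorem elementResidual_mono {π : Set ℕ} {M L : Subgroup G}
    (h : ∀ g ∈ M, IsPiNumber πᶜ (orderOf g) → g ∈ L) :
    elementResidual π M ≤ elementResidual π L :=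
  (closure_le _).mpr fun g hg => mem_elementResidual (h g hg.1 hg.2) hg.2

theorem orderOf_conj (x g : G) : orderOf (x * g * x⁻¹) = orderOf g := by
  simpa using (orderOf_injective (MulAut.conj x).toMonoidHom (MulAut.conj x).injective g)

theorem normalizer_le_normalizer_elementResidual (π : Set ℕ) (M : Subgroup G) :
    normalizer (M : Set G) ≤ normalizer (elementResidual π M : Set G) := by
  refine le_trans ?_ (normalizer_le_normalizer_closure _)
  rw [le_set_normalizer_iff]
  rintro x hx g ⟨hg, ho⟩
  exact ⟨(mem_normalizer_iff.mp hx g).mp hg, by rwa [orderOf_conj]⟩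

theorem elementResidual_normal (π : Set ℕ) (M : Subgroup G) [M.Normal] :
    (elementResidual π M).Normal := by
  rw [← normalizer_eq_top_iff, eq_top_iff, ← normalizer_eq_top (H := M)]
  exact normalizer_le_normalizer_elementResidual π M

/-- For p outside π, a Sylow p-subgroup of M consists of π'-elements, so it lies in the residual and
p cannot divide the index. -/
theorem isPiNumber_relIndex_elementResidual [Finite G] (π : Set ℕ) (M : Subgroup G) :
    IsPiNumber π ((elementResidual π M).relIndex M) := by
  intro p hp hdvd
  by_contra hpπ
  have := Fact.mk hp
  obtain ⟨P⟩ : Nonempty (Sylow p M) := inferInstance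
  have hle : (P : Subgroup M) ≤ (elementResidual π M).subgroupOf M := by
    intro x hx
    rw [mem_subgroupOf]
    refine mem_elementResidual x.2 ?_
    obtain ⟨k, hk⟩ := P.isPGroup' ⟨x, hx⟩
    have hk' : (x : G) ^ p ^ k = 1 := by
      have := congrArg (fun y : P => ((y : M) : G)) hk
      simpa using this
    intro q hq hqd
    have : q = p := (Nat.prime_dvd_prime_iff_eq hq hp).mp
      (hq.dvd_of_dvd_pow (hqd.trans (orderOf_dvd_of_pow_eq_one hk')))
    rwa [this]
  exact P.not_dvd_index (hdvd.trans (index_dvd_of_le hle))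

/-- The index of Q in Q⟨g⟩ divides both |L : Q| and the order of g. Only g has to normalize Q, not
all of L. -/
theorem mem_of_isPiNumber_relIndex {π : Set ℕ} {Q L : Subgroup G} {g : G} (hQ : Q ≤ L)
    (hi : IsPiNumber π (Q.relIndex L)) (hg : g ∈ L) (hn : g ∈ normalizer (Q : Set G))
    (ho : IsPiNumber πᶜ (orderOf g)) : g ∈ Q := by
  have hz : zpowers g ≤ normalizer (Q : Set G) := by rwa [zpowers_le]
  have h1 := relIndex_sup_of_mul_comm (mul_comm_of_le_normalizer hz)
  have h2 : IsPiNumber π (Q.relIndex (zpowers g)) := by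
    rw [← h1]
    exact hi.of_dvd (relIndex_dvd_relIndex_of_le_right le_sup_left
      (sup_le hQ (by rwa [zpowers_le])))
  have h3 : IsPiNumber πᶜ (Q.relIndex (zpowers g)) := by
    refine ho.of_dvd ?_
    rw [← Nat.card_zpowers]
    exact relIndex_dvd_card _ _
  have := relIndex_eq_one.mp (h2.eq_one h3)
  exact this (mem_zpowers g)

theorem mem_of_isPiNumber_index {π : Set ℕ} {Q : Subgroup G} [Q.Normal] {g : G}
    (hi : IsPiNumber π Q.index) (ho : IsPiNumber πᶜ (orderOf g)) : g ∈ Q :=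
  mem_of_isPiNumber_relIndex (L := ⊤) le_top (by rwa [relIndex_top_right]) (mem_top g)
    (by rw [normalizer_eq_top]; trivial) ho

theorem isPiNumber_orderOf {π : Set ℕ} {K : Subgroup G} (h : IsPiGroup π K) {g : G} (hg : g ∈ K) :
    IsPiNumber π (orderOf g) := by
  have := orderOf_dvd_natCard (⟨g, hg⟩ : K)
  rw [orderOf_mk] at this
  exact IsPiNumber.of_dvd h this

end Residual

/-! ### Conjugates, projector systems and permuting subgroups. -/

variable {G : Type*} [Group G]

theorem mem_conjSubgroup {K : Subgroup G} {x g : G} :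
    g ∈ conjSubgroup K x ↔ x * g * x⁻¹ ∈ K := by
  constructor
  · rintro ⟨k, hk, rfl⟩
    simpa [mul_assoc] using hk
  · intro h
    exact ⟨_, h, by simp [mul_assoc]⟩

theorem conjSubgroup_one (K : Subgroup G) : conjSubgroup K 1 = K := by
  ext g; simp [mem_conjSubgroup]

theorem card_conjSubgroup (K : Subgroup G) (x : G) :
    Nat.card (conjSubgroup K x) = Nat.card K :=
  card_map_of_injective (MulAut.conj x⁻¹).injective

theorem IsPiGroup.conj {π : Set ℕ} {K : Subgroup G} (h : IsPiGroup π K) (x : G) :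
    IsPiGroup π (conjSubgroup K x) := by
  rw [IsPiGroup, card_conjSubgroup]; exact h

/-- The consequences of being a projector for the class of `π`-groups that concern normal
subgroups only. -/
structure IsNormalProjector (π : Set ℕ) (K : Subgroup G) : Prop where
  isPiGroup : IsPiGroup π K
  le_sup : ∀ N O : Subgroup G, N.Normal → O.Normal → N ≤ O →
    IsPiNumber π (N.relIndex O) → O ≤ K ⊔ N
  index : ∀ N : Subgroup G, N.Normal → K ≤ N → IsPiNumber πᶜ N.index

theorem conjSubgroup_le_iff {K N : Subgroup G} [hN : N.Normal] {x : G} :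
    conjSubgroup K x ≤ N ↔ K ≤ N := by
  constructor
  · intro h k hk
    have : x⁻¹ * k * x ∈ conjSubgroup K x := by
      rw [mem_conjSubgroup]; simpa [mul_assoc] using hk
    have := hN.conj_mem _ (h this) x
    simpa [mul_assoc] using this
  · intro h g hg
    have := hN.conj_mem _ (h (mem_conjSubgroup.mp hg)) x⁻¹
    simpa [mul_assoc] using this

theorem conjSubgroup_sup_normal (K N : Subgroup G) [hN : N.Normal] (x : G) :
    conjSubgroup K x ⊔ N = conjSubgroup (K ⊔ N) x := by
  rw [conjSubgroup, conjSubgroup, Subgroup.map_sup]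
  congr 1
  exact (Normal.map_conj_eq N x⁻¹).symm

theorem IsNormalProjector.conj {π : Set ℕ} {K : Subgroup G} (h : IsNormalProjector π K)
    (x : G) : IsNormalProjector π (conjSubgroup K x) where
  isPiGroup := h.isPiGroup.conj x
  le_sup N O hN hO hNO hi g hg := by
    rw [conjSubgroup_sup_normal, mem_conjSubgroup]
    exact h.le_sup N O hN hO hNO hi (hO.conj_mem g hg x)
  index N hN hK := h.index N hN (conjSubgroup_le_iff.mp hK)

/-- `K` assigns to each member `s` of `σ` an `s`-subgroup of projector type. -/
structure IsProjectorSystem (σ : Set (Set ℕ)) (K : Set ℕ → Subgroup G) : Prop where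
  exists_mem : ∀ p : ℕ, p.Prime → p ∣ Nat.card G → ∃ s ∈ σ, p ∈ s
  disjoint : σ.PairwiseDisjoint id
  projector : ∀ s ∈ σ, IsNormalProjector s (K s)

/-- `E` permutes with all conjugates of the members of the family `K`. -/
def Permutes (σ : Set (Set ℕ)) (K : Set ℕ → Subgroup G) (E : Subgroup G) : Prop :=
  ∀ s ∈ σ, ∀ x : G, (E : Set G) * (conjSubgroup (K s) x : Set G) =
    (conjSubgroup (K s) x : Set G) * (E : Set G)

theorem Permutes.sup {σ : Set (Set ℕ)} {K : Set ℕ → Subgroup G} {E F : Subgroup G}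
    (hE : Permutes σ K E) (hF : Permutes σ K F) : Permutes σ K (E ⊔ F) := by
  intro s hs x
  refine (mul_comm_of_forall ?_).symm
  set L := conjSubgroup (K s) x
  have key : ∀ y ∈ (E : Set G) ∪ F, ∀ l ∈ L, y * l ∈ (L : Set G) * (E ⊔ F : Subgroup G) := by
    rintro y (hy | hy) l hl
    · obtain ⟨k, hk, e, he, h⟩ : y * l ∈ (L : Set G) * E := by
        rw [← hE s hs x]; exact ⟨y, hy, l, hl, rfl⟩
      exact ⟨k, hk, e, mem_sup_left he, h⟩
    · obtain ⟨k, hk, e, he, h⟩ : y * l ∈ (L : Set G) * F := by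
        rw [← hF s hs x]; exact ⟨y, hy, l, hl, rfl⟩
      exact ⟨k, hk, e, mem_sup_right he, h⟩
  intro y hy
  rw [sup_eq_closure] at hy
  induction hy using closure_induction'' with
  | mem y hy => exact key y hy
  | inv_mem y hy =>
    exact key y⁻¹ (hy.imp E.inv_mem F.inv_mem)
  | one => exact fun l hl => ⟨l, hl, 1, one_mem _, by simp⟩
  | mul a b ha hb iha ihb =>
    intro l hl
    obtain ⟨k, hk, e, he, h⟩ := ihb l hl
    obtain ⟨k', hk', e', he', h'⟩ := iha k hk
    refine ⟨k', hk', e' * e, mul_mem he' he, ?_⟩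
    simp only at h h' ⊢
    rw [mul_assoc, ← h, ← mul_assoc, h', mul_assoc]

theorem Permutes.sup_normal {σ : Set (Set ℕ)} {K : Set ℕ → Subgroup G} {E : Subgroup G}
    (hE : Permutes σ K E) (N : Subgroup G) [N.Normal] : Permutes σ K (E ⊔ N) :=
  hE.sup fun _ _ _ => (set_mul_normal_comm _ _).symm

theorem Permutes.conj {σ : Set (Set ℕ)} {K : Set ℕ → Subgroup G} {E : Subgroup G}
    (hE : Permutes σ K E) (b : G) : Permutes σ K (conjSubgroup E b) := by
  intro s hs x
  refine mul_comm_of_forall ?_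
  intro k hk e he
  rw [mem_conjSubgroup] at hk he
  obtain ⟨e', he', k', hk', h⟩ : (b * k * b⁻¹) * (b * e * b⁻¹) ∈
      (E : Set G) * (conjSubgroup (K s) (x * b⁻¹) : Set G) := by
    rw [hE s hs (x * b⁻¹)]
    refine ⟨_, ?_, _, he, rfl⟩
    rw [SetLike.mem_coe, mem_conjSubgroup]
    simpa [mul_assoc] using hk
  refine ⟨b⁻¹ * e' * b, ?_, b⁻¹ * k' * b, ?_, ?_⟩
  · rw [SetLike.mem_coe, mem_conjSubgroup]; simpa [mul_assoc] using he'
  · rw [SetLike.mem_coe, mem_conjSubgroup] at hk' ⊢; simpa [mul_assoc] using hk'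
  · have : b⁻¹ * (e' * k') * b = k * e := by
      simp only at h; rw [h]; group
    rw [← this]; group

section Numbers

variable {σ : Set (Set ℕ)} {K : Set ℕ → Subgroup G}

theorem IsProjectorSystem.compl_of_ne (hK : IsProjectorSystem σ K) {s t : Set ℕ} (hs : s ∈ σ)
    (ht : t ∈ σ) (hst : t ≠ s) {n : ℕ} (h : IsPiNumber t n) : IsPiNumber sᶜ n :=
  h.mono (Set.disjoint_left.mp (hK.disjoint ht hs hst))

theorem IsProjectorSystem.isPiNumber_of_forall (hK : IsProjectorSystem σ K) {s : Set ℕ} {n : ℕ}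
    (hn : n ∣ Nat.card G) (h : ∀ t ∈ σ, t ≠ s → IsPiNumber tᶜ n) : IsPiNumber s n := by
  intro p hp hpn
  obtain ⟨t, ht, hpt⟩ := hK.exists_mem p hp (hpn.trans hn)
  by_cases hts : t = s
  · rwa [← hts]
  · exact absurd hpt (h t ht hts p hp hpn)

theorem IsProjectorSystem.eq_one_of_forall (hK : IsProjectorSystem σ K) {n : ℕ}
    (hn : n ∣ Nat.card G) (h : ∀ t ∈ σ, IsPiNumber tᶜ n) : n = 1 := by
  by_contra h1
  obtain ⟨p, hp, hpn⟩ := Nat.exists_prime_and_dvd h1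
  obtain ⟨t, ht, hpt⟩ := hK.exists_mem p hp (hpn.trans hn)
  exact h t ht p hp hpn hpt

theorem relIndex_dvd_natCard (A B : Subgroup G) : A.relIndex B ∣ Nat.card G :=
  (relIndex_dvd_card A B).trans (card_subgroup_dvd_card B)

end Numbers

/-! ### Index clashes between a permuting subgroup and the projectors. -/

section Permuting

variable {σ : Set (Set ℕ)} {K : Set ℕ → Subgroup G}

/-- An element of order prime to `s` normalizes `E ⊓ M` if `E` permutes with the system and has
`s`-index in the normal subgroup `M`. -/
theorem Permutes.mem_normalizer (hK : IsProjectorSystem σ K) {E : Subgroup G}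
    (hE : Permutes σ K E) {s : Set ℕ} (M : Subgroup G) [M.Normal]
    (hs : s ∈ σ) (hi : IsPiNumber s (E.relIndex M)) {g : G} (hg : IsPiNumber sᶜ (orderOf g)) :
    g ∈ normalizer ((E ⊓ M : Subgroup G) : Set G) := by
  set Q := normalizer ((E ⊓ M : Subgroup G) : Set G)
  have key : ∀ t ∈ σ, t ≠ s → ∀ x, conjSubgroup (K t) x ≤ Q := by
    intro t ht hts x
    set L := conjSubgroup (K t) x
    have h1 : IsPiNumber t (E.relIndex (M ⊓ (E ⊔ L))) := by
      refine IsPiNumber.of_dvd ?_ (relIndex_normal_inf_dvd M (le_sup_left : E ≤ E ⊔ L))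
      rw [relIndex_sup_of_mul_comm (hE t ht x)]
      exact IsPiNumber.of_dvd ((hK.projector t ht).isPiGroup.conj x)
        (relIndex_dvd_card _ _)
    have e : E.relIndex (M ⊓ (E ⊔ L)) = (E ⊓ M).relIndex (M ⊓ (E ⊔ L)) := by
      rw [← inf_relIndex_right E, ← inf_relIndex_right (E ⊓ M), inf_assoc, ← inf_assoc M, inf_idem]
    have h2 : IsPiNumber s (E.relIndex (M ⊓ (E ⊔ L))) := by
      rw [e]
      refine hi.of_dvd ?_
      rw [← inf_relIndex_right E M]
      exact relIndex_dvd_relIndex_of_le_right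
        (le_inf inf_le_right (inf_le_left.trans le_sup_left)) inf_le_left
    -- The index of E in M ∩ EL is an s-number by `h2` and a t-number by `h1`, hence 1.
    have h3 : M ⊓ (E ⊔ L) ≤ E := by
      rw [← relIndex_eq_one]
      exact h2.eq_one (hK.compl_of_ne hs ht hts h1)
    have h4 : E ⊓ M = M ⊓ (E ⊔ L) :=
      le_antisymm (le_inf inf_le_right (inf_le_left.trans le_sup_left)) (le_inf h3 inf_le_left)
    have h5 : L ≤ normalizer ((M ⊓ (E ⊔ L) : Subgroup G) : Set G) := by
      rw [le_normalizer_iff]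
      rintro l hl y ⟨hyM, hyJ⟩
      have hl' : l ∈ E ⊔ L := mem_sup_right hl
      exact ⟨‹M.Normal›.conj_mem y hyM l, mul_mem (mul_mem hl' hyJ) ((E ⊔ L).inv_mem hl')⟩
    rwa [← h4] at h5
  have hcore : ∀ t ∈ σ, t ≠ s → K t ≤ Q.normalCore := by
    intro t ht hts k hk x
    refine key t ht hts x⁻¹ ?_
    rw [mem_conjSubgroup]
    simpa [mul_assoc] using hk
  -- The core contains K_t for every t ≠ s, so its index is prime to every such t.
  have hidx : IsPiNumber s Q.normalCore.index :=
    hK.isPiNumber_of_forall (index_dvd_card _) fun t ht hts =>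
      (hK.projector t ht).index _ inferInstance (hcore t ht hts)
  exact Q.normalCore_le (mem_of_isPiNumber_index hidx hg)

theorem Permutes.mem_of_mem_normal (hK : IsProjectorSystem σ K) {E : Subgroup G}
    (hE : Permutes σ K E) {s : Set ℕ} (M : Subgroup G) [M.Normal]
    (hs : s ∈ σ) (hi : IsPiNumber s (E.relIndex M)) {g : G} (hgM : g ∈ M)
    (hg : IsPiNumber sᶜ (orderOf g)) :
    g ∈ E :=
  (mem_of_isPiNumber_relIndex (Q := E ⊓ M) inf_le_right (by rwa [inf_relIndex_right]) hgM
    (hE.mem_normalizer hK M hs hi hg) hg).1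

/-- By Dedekind's argument E also permutes with K_t^x ∩ Z, and the index of E in their product is
both an s-number and a t-number. -/
theorem Permutes.conj_inf_le (hK : IsProjectorSystem σ K) {E Z : Subgroup G}
    (hE : Permutes σ K E) (hEZ : E ≤ Z) {s t : Set ℕ} (hs : s ∈ σ) (ht : t ∈ σ) (hts : t ≠ s)
    (hi : IsPiNumber s (E.relIndex Z)) (x : G) : conjSubgroup (K t) x ⊓ Z ≤ E := by
  set L := conjSubgroup (K t) x
  have hc : (E : Set G) * ((L ⊓ Z : Subgroup G) : Set G) =
      ((L ⊓ Z : Subgroup G) : Set G) * E := by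
    refine mul_comm_of_forall ?_
    rintro k ⟨hk, hkZ⟩ e he
    obtain ⟨e', he', k', hk', h⟩ : k * e ∈ (E : Set G) * (L : Set G) := by
      rw [hE t ht x]; exact ⟨k, hk, e, he, rfl⟩
    refine ⟨e', he', k', ⟨hk', ?_⟩, h⟩
    have : k' = e'⁻¹ * (k * e) := by simp only at h; rw [← h]; group
    rw [this]
    exact mul_mem (Z.inv_mem (hEZ he')) (mul_mem hkZ (hEZ he))
  rw [← relIndex_eq_one]
  refine IsPiNumber.eq_one (π := s) ?_ (hK.compl_of_ne hs ht hts ?_)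
  · rw [← relIndex_sup_of_mul_comm hc]
    exact hi.of_dvd (relIndex_dvd_relIndex_of_le_right le_sup_left (sup_le hEZ inf_le_right))
  · exact IsPiNumber.of_dvd ((hK.projector t ht).isPiGroup.conj x)
      ((relIndex_dvd_card _ _).trans (card_dvd_of_le inf_le_left))

end Permuting

/-! ### σ-nilpotent sections, and the dichotomy for a minimal normal subgroup. -/

theorem relIndex_dvd_of_normal_left {C A B : Subgroup G} [C.Normal] (h : B ≤ A) :
    C.relIndex B ∣ C.relIndex A := by
  rw [← relIndex_sup_left (K := C) (H := B), ← relIndex_sup_left (K := C) (H := A)]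
  exact relIndex_dvd_relIndex_of_le_right le_sup_left (sup_le_sup_left h C)

/-- The section `X / C` is `σ`-nilpotent, witnessed by normal subgroups of the whole group. -/
def IsSigmaNilpotentSection (σ : Set (Set ℕ)) (X C : Subgroup G) : Prop :=
  ∀ s ∈ σ, ∃ A : Subgroup G, A.Normal ∧ C ≤ A ∧ A ≤ X ∧ IsPiNumber s (C.relIndex A) ∧
    IsPiNumber sᶜ (A.relIndex X)

theorem isSigmaNilpotentSection_self (σ : Set (Set ℕ)) (X : Subgroup G) [X.Normal] :
    IsSigmaNilpotentSection σ X X :=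
  fun s _ => ⟨X, inferInstance, le_rfl, le_rfl, by rw [relIndex_self]; exact isPiNumber_one s,
    by rw [relIndex_self]; exact isPiNumber_one sᶜ⟩

theorem IsSigmaNilpotentSection.restrict {σ : Set (Set ℕ)} {X Y C : Subgroup G} [C.Normal]
    [Y.Normal] (h : IsSigmaNilpotentSection σ X C) (hY : Y ≤ X) :
    IsSigmaNilpotentSection σ Y (C ⊓ Y) := by
  intro s hs
  obtain ⟨A, hA, hCA, hAX, h1, h2⟩ := h s hs
  refine ⟨A ⊓ Y, inferInstance, inf_le_inf_right Y hCA, inf_le_right, ?_, ?_⟩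
  · rw [← inf_relIndex_right, inf_assoc, inf_eq_right.mpr (inf_le_right : A ⊓ Y ≤ Y),
      inf_relIndex_right]
    exact h1.of_dvd (relIndex_dvd_of_normal_left inf_le_left)
  · rw [inf_relIndex_right]
    exact h2.of_dvd (relIndex_dvd_of_normal_left hY)

/-- X/(C ∩ D) is a subdirect product of X/C and X/D; intersecting the two witnesses keeps them
normal in G. -/
theorem IsSigmaNilpotentSection.inf {σ : Set (Set ℕ)} {X C D : Subgroup G} [C.Normal] [D.Normal]
    (hC : IsSigmaNilpotentSection σ X C) (hD : IsSigmaNilpotentSection σ X D) :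
    IsSigmaNilpotentSection σ X (C ⊓ D) := by
  intro s hs
  obtain ⟨A, hA, hCA, hAX, h1, h2⟩ := hC s hs
  obtain ⟨B, hB, hDB, hBX, h3, h4⟩ := hD s hs
  refine ⟨A ⊓ B, inferInstance, inf_le_inf hCA hDB, inf_le_left.trans hAX, ?_, ?_⟩
  · rw [← relIndex_inf_mul_relIndex]
    exact (h1.of_dvd (relIndex_dvd_of_normal_left (inf_le_right.trans inf_le_left))).mul
      (h3.of_dvd (relIndex_dvd_of_normal_left inf_le_right))
  · rw [← relIndex_inf_mul_relIndex]
    exact (h2.of_dvd (relIndex_dvd_of_normal_left inf_le_right)).mul h4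

theorem mem_normalizer_of_conjSubgroup_le [Finite G] {A : Subgroup G} {b : G}
    (h : conjSubgroup A b ≤ A) : b ∈ normalizer (A : Set G) := by
  have h1 : conjSubgroup A b = A := eq_of_le_of_card_ge h (card_conjSubgroup A b).ge
  have : b⁻¹ ∈ normalizer (A : Set G) := by
    rw [mem_normalizer_iff_map_conj_eq]; exact h1
  simpa using inv_mem this

/-- If `N` is minimal among the normal subgroups above the core of a permuting subgroup `H`, then
`N` meets the normal closure of `H` in the core, or `N` is an `s`-group modulo the core. -/
theorem Permutes.inf_normalClosure_le_or [Finite G] {σ : Set (Set ℕ)} {K : Set ℕ → Subgroup G}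
    (hK : IsProjectorSystem σ K) {H : Subgroup G} (hH : Permutes σ K H) (N : Subgroup G)
    [N.Normal] (hNH : ¬ N ≤ H) (hCN : H.normalCore ≤ N)
    (hmin : ∀ R : Subgroup G, R.Normal → H.normalCore ≤ R → R ≤ N → R = H.normalCore ∨ R = N) :
    N ⊓ normalClosure (H : Set G) ≤ H.normalCore ∨
      ∃ s ∈ σ, IsPiNumber s (H.normalCore.relIndex N) := by
  -- A is a maximal permuting subgroup above H that does not contain N; the cases are whether all
  -- conjugates of the projectors normalize A.
  obtain ⟨A, hHA, hA⟩ :=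
    (Set.toFinite {A : Subgroup G | Permutes σ K A ∧ H ≤ A ∧ ¬ N ≤ A}).exists_le_maximal
    (a := H) ⟨hH, le_rfl, hNH⟩
  obtain ⟨hAP, -, hNA⟩ := hA.prop
  by_cases hall : ∀ t ∈ σ, ∀ y, conjSubgroup (K t) y ≤ normalizer (A : Set G)
  · left
    have hcore : ∀ t ∈ σ, K t ≤ (normalizer (A : Set G)).normalCore := by
      intro t ht k hk x
      refine hall t ht x⁻¹ ?_
      rw [mem_conjSubgroup]
      simpa [mul_assoc] using hk
    have h1 : (normalizer (A : Set G)).normalCore.index = 1 :=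
      hK.eq_one_of_forall (index_dvd_card _) fun t ht =>
        (hK.projector t ht).index _ inferInstance (hcore t ht)
    have hAn : A.Normal := by
      rw [← normalizer_eq_top_iff, eq_top_iff, ← index_eq_one.mp h1]
      exact normalCore_le _
    have hX : normalClosure (H : Set G) ≤ A := normalClosure_le_normal hHA
    rcases hmin (N ⊓ A) inferInstance (le_inf hCN ((normalCore_le H).trans hHA)) inf_le_left
      with h | h
    · rw [← h]; exact inf_le_inf_left N hX
    · exact absurd (inf_eq_left.mp h) hNA
  · right
    push Not at hall
    obtain ⟨t, ht, y, hy⟩ := hall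
    obtain ⟨b, hb, hbn⟩ := Set.not_subset.mp hy
    set L := conjSubgroup (K t) y
    refine ⟨t, ht, ?_⟩
    -- The join of A with its conjugate again permutes and is strictly larger because b does not
    -- normalize A, so maximality puts N inside it. As b lies in L, it also lies in AL.
    have hNF : N ≤ A ⊔ conjSubgroup A b := by
      by_contra hNF
      have := hA.le_of_ge (y := A ⊔ conjSubgroup A b)
        ⟨hAP.sup (hAP.conj b), hHA.trans le_sup_left, hNF⟩ le_sup_left
      exact hbn (mem_normalizer_of_conjSubgroup_le (le_sup_right.trans this))
    have hNJ : N ≤ A ⊔ L := by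
      refine hNF.trans (sup_le le_sup_left ?_)
      intro g hg
      have h1 := mem_conjSubgroup.mp hg
      have hb' : b ∈ A ⊔ L := mem_sup_right hb
      have : g = b⁻¹ * (b * g * b⁻¹) * b := by group
      rw [this]
      exact mul_mem (mul_mem ((A ⊔ L).inv_mem hb') (mem_sup_left h1)) hb'
    have h1 : IsPiNumber t (A.relIndex N) := by
      rw [← inf_eq_left.mpr hNJ]
      refine IsPiNumber.of_dvd ?_ (relIndex_normal_inf_dvd N (le_sup_left : A ≤ A ⊔ L))
      rw [relIndex_sup_of_mul_comm (hAP t ht y)]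
      exact IsPiNumber.of_dvd ((hK.projector t ht).isPiGroup.conj y) (relIndex_dvd_card _ _)
    have h2 : elementResidual t N ≤ A :=
      (closure_le _).mpr fun g hg => hAP.mem_of_mem_normal hK N ht h1 hg.1 hg.2
    have := elementResidual_normal t N
    -- O^t(N)C is normal between C and N; it lies in A, which does not contain N, so it equals C.
    have h3 : elementResidual t N ⊔ H.normalCore ≤ A := sup_le h2 ((normalCore_le H).trans hHA)
    have h4 : elementResidual t N ≤ H.normalCore := by
      rcases hmin (elementResidual t N ⊔ H.normalCore) inferInstance le_sup_right
        (sup_le (elementResidual_le t N) hCN) with h | h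
      · rw [← h]; exact le_sup_left
      · exact absurd (h ▸ h3) hNA
    exact (isPiNumber_relIndex_elementResidual t N).of_dvd (relIndex_dvd_of_le_left N h4)

/-! ### Central Hall subgroups. -/

/-- A Schur–Zassenhaus complement of Z is normal because Z is central. It has π-index, so it
contains all π'-elements and is the whole group. -/
theorem eq_bot_of_le_center {Q : Type*} [Group Q] [Finite Q] {π : Set ℕ} {Z : Subgroup Q}
    (hZ : Z ≤ center Q) (hZc : IsPiNumber π (Nat.card Z)) (hZi : IsPiNumber πᶜ Z.index)
    (hQ : elementResidual π (⊤ : Subgroup Q) = ⊤) : Z = ⊥ := by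
  have : Z.Normal := ⟨fun z hz g => by
    rw [mem_center_iff.mp (hZ hz) g]; simpa [mul_assoc] using hz⟩
  obtain ⟨U, hU⟩ := exists_right_complement'_of_coprime (hZc.coprime hZi)
  have hUn : U.Normal := by
    refine ⟨fun u hu g => ?_⟩
    obtain ⟨⟨⟨z, hz⟩, ⟨v, hv⟩⟩, rfl⟩ := hU.2 g
    have hc := mem_center_iff.mp (hZ hz) (v * u * v⁻¹)
    have : z * v * u * (z * v)⁻¹ = v * u * v⁻¹ := by
      have : z * v * u * (z * v)⁻¹ = z * (v * u * v⁻¹) * z⁻¹ := by group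
      rw [this, ← hc]; group
    simp only [this]
    exact U.mul_mem (U.mul_mem hv hu) (U.inv_mem hv)
  have hUi : IsPiNumber π U.index := by
    rwa [← hU.symm.card_right]
  have hUt : U = ⊤ := by
    rw [eq_top_iff, ← hQ, elementResidual, closure_le]
    exact fun g hg => mem_of_isPiNumber_index hUi hg.2
  have := hU.disjoint
  rwa [hUt, disjoint_top] at this

/-- In D/(C ∩ D) the image of M ∩ D is a central Hall π-subgroup, so `eq_bot_of_le_center` applies.
-/
theorem inf_le_of_le_centralizer [Finite G] {π : Set ℕ} {C M D : Subgroup G} [C.Normal]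
    (hCM : C ≤ M) (hM : IsPiNumber π (C.relIndex M)) (hD : IsPiNumber πᶜ (M.relIndex D))
    (hDM : ∀ m ∈ M, ∀ d ∈ D, m * d * m⁻¹ * d⁻¹ ∈ C) (hDe : D ≤ elementResidual π D) :
    M ⊓ D ≤ C := by
  let f := QuotientGroup.mk' (C.subgroupOf D)
  have hker : f.ker = C.subgroupOf D := QuotientGroup.ker_mk' _
  have hf : Function.Surjective f := QuotientGroup.mk'_surjective _
  have hZ : (M.subgroupOf D).map f = ⊥ := by
    refine eq_bot_of_le_center (π := π) ?_ ?_ ?_ ?_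
    · rintro _ ⟨⟨m, hmD⟩, hm, rfl⟩
      rw [mem_center_iff]
      intro q
      obtain ⟨⟨d, hd⟩, rfl⟩ := hf q
      rw [← map_mul, ← map_mul]
      refine (QuotientGroup.eq.mpr ?_)
      have h := ‹C.Normal›.conj_mem _ (hDM m⁻¹ (M.inv_mem hm) d⁻¹ (D.inv_mem hd)) 1
      rw [mem_subgroupOf]
      simpa [mul_assoc] using h
    · rw [← relIndex_ker, hker, subgroupOf, relIndex_comap, subgroupOf_map_subtype]
      exact hM.of_dvd (relIndex_dvd_of_normal_left inf_le_left)
    · rw [index_map_eq _ hf (by rw [hker]; exact comap_mono hCM)]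
      exact hD
    · rw [eq_top_iff]
      intro q _
      obtain ⟨⟨d, hd⟩, rfl⟩ := hf q
      have hle : elementResidual π D ≤
          ((elementResidual π (⊤ : Subgroup (D ⧸ C.subgroupOf D))).comap f).map D.subtype := by
        refine (closure_le _).mpr fun g hg => ⟨⟨g, hg.1⟩, ?_, rfl⟩
        refine mem_elementResidual (mem_top _) (hg.2.of_dvd ?_)
        have := orderOf_map_dvd f ⟨g, hg.1⟩
        rwa [orderOf_mk] at this
      obtain ⟨x, hx, hxd⟩ := hle (hDe hd)
      have : x = ⟨d, hd⟩ := Subtype.ext hxd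
      rw [← this]; exact hx
  rintro g ⟨hgM, hgD⟩
  have : (⟨g, hgD⟩ : D) ∈ f.ker := by
    have h1 : f ⟨g, hgD⟩ ∈ (M.subgroupOf D).map f := mem_map_of_mem f hgM
    rw [hZ, mem_bot] at h1
    exact h1
  rw [hker] at this
  exact this

theorem le_normalizer_closure_of_conj {π : Set ℕ} {S : Set G}
    (h : ∀ g : G, IsPiNumber π (orderOf g) → ∀ x ∈ S, g * x * g⁻¹ ∈ S) {g : G}
    (hg : IsPiNumber π (orderOf g)) : g ∈ normalizer (closure S : Set G) := by
  have : zpowers g ≤ normalizer (closure S : Set G) := by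
    refine le_trans ?_ (normalizer_le_normalizer_closure S)
    rw [le_set_normalizer_iff]
    exact fun y hy x hx => h y (hg.of_dvd (orderOf_dvd_of_mem_zpowers hy)) x hx
  exact this (mem_zpowers g)

/-! ### The case where M is an s-group modulo the core. -/

section Minimal

variable {σ : Set (Set ℕ)} {K : Set ℕ → Subgroup G}

/-- There is a normal subgroup between `M` and `X` that induces the Hall `s'`-subgroup of the
`σ`-nilpotent section `X / M`. -/
theorem IsSigmaNilpotentSection.exists_compl [Finite G] (hK : IsProjectorSystem σ K)
    {X M : Subgroup G} [X.Normal] [M.Normal] (hMX : M ≤ X) (h : IsSigmaNilpotentSection σ X M) {s : Set ℕ}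
    (hs : s ∈ σ) : ∃ V : Subgroup G, V.Normal ∧ M ≤ V ∧ V ≤ X ∧ IsPiNumber sᶜ (M.relIndex V) ∧
      IsPiNumber s (V.relIndex X) := by
  obtain ⟨V, hMV, hV⟩ := (Set.toFinite {V : Subgroup G | V.Normal ∧ M ≤ V ∧ V ≤ X ∧
    IsPiNumber sᶜ (M.relIndex V)}).exists_le_maximal (a := M)
      ⟨inferInstance, le_rfl, hMX, by rw [relIndex_self]; exact isPiNumber_one _⟩
  obtain ⟨hVn, -, hVX, hVi⟩ := hV.prop
  refine ⟨V, hVn, hMV, hVX, hVi, hK.isPiNumber_of_forall (relIndex_dvd_natCard _ _) ?_⟩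
  intro t ht hts
  obtain ⟨A, hA, hMA, hAX, h1, h2⟩ := h t ht
  have hAV : A ≤ V := by
    refine le_sup_right.trans (hV.le_of_ge (y := V ⊔ A) ⟨inferInstance, hMV.trans le_sup_left,
      sup_le hVX hAX, ?_⟩ le_sup_left)
    rw [← relIndex_mul_relIndex M V (V ⊔ A) hMV le_sup_left, relIndex_sup_left]
    exact hVi.mul ((hK.compl_of_ne hs ht hts h1).of_dvd (relIndex_dvd_of_le_left A hMV))
  exact h2.of_dvd (relIndex_dvd_of_le_left X hAV)

/-- G = O^s(G) O^{s'}(G), since the index of this product is both an s-number and an s'-number. -/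
theorem exists_mul_of_normalizer [Finite G] (s : Set ℕ) {P Q : Subgroup G}
    (hP : ∀ g, IsPiNumber sᶜ (orderOf g) → g ∈ P) (hQ : ∀ g, IsPiNumber s (orderOf g) → g ∈ Q)
    (g : G) : ∃ p ∈ P, ∃ q ∈ Q, g = p * q := by
  have hW := elementResidual_normal s (⊤ : Subgroup G)
  have hY := elementResidual_normal sᶜ (⊤ : Subgroup G)
  have hWP : elementResidual s (⊤ : Subgroup G) ≤ P := (closure_le _).mpr fun g hg => hP g hg.2
  have hYQ : elementResidual sᶜ (⊤ : Subgroup G) ≤ Q :=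
    (closure_le _).mpr fun g hg => hQ g (by simpa using hg.2)
  have h1 := isPiNumber_relIndex_elementResidual s (⊤ : Subgroup G)
  have h2 := isPiNumber_relIndex_elementResidual sᶜ (⊤ : Subgroup G)
  have h3 : elementResidual s (⊤ : Subgroup G) ⊔ elementResidual sᶜ (⊤ : Subgroup G) = ⊤ := by
    rw [eq_top_iff, ← relIndex_eq_one]
    exact (h1.of_dvd (relIndex_dvd_of_le_left _ le_sup_left)).eq_one
      (h2.of_dvd (relIndex_dvd_of_le_left _ le_sup_right))
  have hg : g ∈ ((elementResidual s (⊤ : Subgroup G) ⊔ elementResidual sᶜ (⊤ : Subgroup G) :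
      Subgroup G) : Set G) := by rw [h3]; trivial
  rw [mul_normal] at hg
  obtain ⟨w, hw, y, hy, rfl⟩ := hg
  exact ⟨w, hWP hw, y, hYQ hy, rfl⟩

/-- O^s(M) lies in H by `Permutes.mem_of_mem_normal` and is normal in G, so it lies in the core. -/
theorem Permutes.isPiNumber_core_relIndex [Finite G] (hK : IsProjectorSystem σ K) {H : Subgroup G}
    (hH : Permutes σ K H) {s : Set ℕ} (hs : s ∈ σ) (M : Subgroup G) [M.Normal]
    (hi : IsPiNumber s (H.relIndex M)) : IsPiNumber s (H.normalCore.relIndex M) := by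
  have := elementResidual_normal s M
  have h : elementResidual s M ≤ H.normalCore := normal_le_normalCore.mpr
    ((closure_le _).mpr fun g hg => hH.mem_of_mem_normal hK M hs hi hg.1 hg.2)
  exact (isPiNumber_relIndex_elementResidual s M).of_dvd (relIndex_dvd_of_le_left M h)

/-- If `M` is a normal `s`-group modulo the core of `H` and `X / M` is `σ`-nilpotent, then
`H` contains the elements of `H ⊔ M` whose order is prime to `s`. -/
theorem Permutes.mem_of_mem_sup (hK : IsProjectorSystem σ K) {H : Subgroup G}
    (hH : Permutes σ K H) {s : Set ℕ} (hs : s ∈ σ) {M X : Subgroup G} [M.Normal] [X.Normal]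
    (hi : IsPiNumber s (H.normalCore.relIndex M)) (hX : H ⊔ M ≤ X)
    (hSN : IsSigmaNilpotentSection σ X M) {g : G} (hgE : g ∈ H ⊔ M)
    (hg : IsPiNumber sᶜ (orderOf g)) : g ∈ H := by
  set C := H.normalCore
  set E := H ⊔ M with hE
  have hHE : H ≤ E := le_sup_left
  have hME : M ≤ E := le_sup_right
  have hCH : C ≤ H := normalCore_le H
  have hEi : IsPiNumber s (H.relIndex E) := by
    rw [hE, relIndex_sup_normal]
    exact hi.of_dvd (relIndex_dvd_of_le_left M hCH)
  -- `closure S` is a subgroup of H that is normal in E, since all conjugates of the K_t are used.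
  -- It remains to see that it has s-index in E.
  set S : Set G := {g | g ∈ E ∧ (g ∈ C ∨ ∃ t ∈ σ, t ≠ s ∧ ∃ x, g ∈ conjSubgroup (K t) x)}
  have hSE : closure S ≤ E := (closure_le _).mpr fun g hg => hg.1
  have hSH : closure S ≤ H := by
    refine (closure_le _).mpr ?_
    rintro g ⟨hgE, hgC | ⟨t, ht, hts, x, hx⟩⟩
    · exact hCH hgC
    · exact hH.conj_inf_le hK hHE hs ht hts hEi x ⟨hx, hgE⟩
  have hn : E ≤ normalizer (closure S : Set G) := by
    refine le_trans ?_ (normalizer_le_normalizer_closure S)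
    rw [le_set_normalizer_iff]
    rintro y hy g ⟨hgE, hgC⟩
    refine ⟨mul_mem (mul_mem hy hgE) (E.inv_mem hy),
      hgC.imp (fun h => H.normalCore_normal.conj_mem g h y) ?_⟩
    rintro ⟨t, ht, hts, x, hx⟩
    refine ⟨t, ht, hts, x * y⁻¹, ?_⟩
    rw [mem_conjSubgroup] at hx ⊢
    simpa [mul_assoc] using hx
  have hLi : IsPiNumber s ((closure S).relIndex E) := by
    rw [← relIndex_mul_relIndex (closure S) (closure S ⊔ M) E le_sup_left (sup_le hSE hME),
      relIndex_sup_normal]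
    refine IsPiNumber.mul (hi.of_dvd (relIndex_dvd_of_le_left M ?_)) ?_
    · exact fun g hg => subset_closure ⟨hHE (hCH hg), Or.inl hg⟩
    · refine hK.isPiNumber_of_forall (relIndex_dvd_natCard _ _) fun t ht hts => ?_
      obtain ⟨A, hA, hMA, hAX, h1, h2⟩ := hSN t ht
      -- K_t covers the normal t-section A/M, so modulo M every element of A ∩ E comes from K_t ∩ E.
      have hle : A ⊓ E ≤ closure S ⊔ M := by
        rintro g ⟨hgA, hgE⟩
        have hg' := (hK.projector t ht).le_sup M A inferInstance hA hMA h1 hgA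
        obtain ⟨k, hk, m, hm, rfl⟩ := mem_sup_of_normal_right.mp hg'
        have hkE : k ∈ E := by
          have := mul_mem hgE (E.inv_mem (hME hm))
          simpa using this
        refine mul_mem (mem_sup_left (subset_closure ⟨hkE, Or.inr ⟨t, ht, hts, 1, ?_⟩⟩))
          (mem_sup_right hm)
        rwa [conjSubgroup_one]
      refine IsPiNumber.of_dvd ?_ (relIndex_dvd_of_le_left E hle)
      rw [inf_relIndex_right]
      exact h2.of_dvd (relIndex_dvd_of_normal_left hX)
  exact hSH (mem_of_isPiNumber_relIndex hSE hLi hgE (hn hgE) hg)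

/-- If `X / M` is `σ`-nilpotent and `E` is a permuting subgroup between `M` and `X`, then every
`s`-element of `G` normalizes the `s`-residual of `E`. -/
theorem Permutes.mem_normalizer_elementResidual (hK : IsProjectorSystem σ K) {E : Subgroup G}
    (hE : Permutes σ K E) {s : Set ℕ} (hs : s ∈ σ) {M X : Subgroup G} [M.Normal]
    (hME : M ≤ E) (hX : E ≤ X) (hSN : IsSigmaNilpotentSection σ X M) {g : G}
    (hg : IsPiNumber s (orderOf g)) : g ∈ normalizer (elementResidual s E : Set G) := by
  choose! A hA hMA hAX hA1 hA2 using hSN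
  -- For t ≠ s an s-element is a t'-element, so it normalizes each E ∩ A_t. Together these generate
  -- a normal subgroup of s-index in E, which has the same s-residual as E.
  set S : Set G := {g | g ∈ E ∧ ∃ t ∈ σ, t ≠ s ∧ g ∈ A t}
  have hSE : closure S ≤ E := (closure_le _).mpr fun g hg => hg.1
  have hn : E ≤ normalizer (closure S : Set G) := by
    refine le_trans ?_ (normalizer_le_normalizer_closure S)
    rw [le_set_normalizer_iff]
    rintro y hy g ⟨hgE, t, ht, hts, hgA⟩
    exact ⟨mul_mem (mul_mem hy hgE) (E.inv_mem hy), t, ht, hts, (hA t ht).conj_mem g hgA y⟩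
  have hSi : IsPiNumber s ((closure S).relIndex E) := by
    refine hK.isPiNumber_of_forall (relIndex_dvd_natCard _ _) fun t ht hts => ?_
    have hle : A t ⊓ E ≤ closure S := fun g hg => subset_closure ⟨hg.2, t, ht, hts, hg.1⟩
    refine IsPiNumber.of_dvd ?_ (relIndex_dvd_of_le_left E hle)
    rw [inf_relIndex_right]
    have := hA t ht
    exact (hA2 t ht).of_dvd (relIndex_dvd_of_normal_left hX)
  have hgS : g ∈ normalizer (closure S : Set G) := by
    refine le_normalizer_closure_of_conj (π := s) ?_ hg
    rintro g hg x ⟨hxE, t, ht, hts, hxA⟩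
    have := hA t ht
    have h1 := hE.mem_normalizer hK (A t) ht
      ((hA1 t ht).of_dvd (relIndex_dvd_of_le_left (A t) hME)) (hK.compl_of_ne ht hs hts.symm hg)
    have h2 := (mem_normalizer_iff.mp h1 x).mp ⟨hxE, hxA⟩
    exact ⟨h2.1, t, ht, hts, h2.2⟩
  have heq : elementResidual s (closure S) = elementResidual s E :=
    le_antisymm (elementResidual_mono fun g hg _ => hSE hg)
      (elementResidual_mono fun g hg ho => mem_of_isPiNumber_relIndex hSE hSi hg (hn hg) ho)
  rw [← heq]
  exact normalizer_le_normalizer_elementResidual s _ hgS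

theorem Permutes.isSigmaNilpotentSection_of_isPiNumber [Finite G] (hK : IsProjectorSystem σ K)
    {H : Subgroup G} (hH : Permutes σ K H) {s : Set ℕ} (hs : s ∈ σ) {M X : Subgroup G} [M.Normal]
    [X.Normal] (hCM : H.normalCore ≤ M) (hi : IsPiNumber s (H.normalCore.relIndex M))
    (hX : H ⊔ M ≤ X) (hSN : IsSigmaNilpotentSection σ X M) :
    IsSigmaNilpotentSection σ (normalClosure (H : Set G)) H.normalCore := by
  set C := H.normalCore
  set E := H ⊔ M with hE
  set Y := normalClosure (H : Set G)
  have hHE : H ≤ E := le_sup_left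
  have hME : M ≤ E := le_sup_right
  have hCH : C ≤ H := normalCore_le H
  have hHY : H ≤ Y := le_normalClosure
  have hYX : Y ≤ X := normalClosure_le_normal (hHE.trans hX)
  set T := elementResidual s H
  have hTE : T = elementResidual s E :=
    le_antisymm (elementResidual_mono fun g hg _ => hHE hg)
      (elementResidual_mono fun g hg ho => hH.mem_of_mem_sup hK hs hi hX hSN hg ho)
  have hTH : T ≤ H := elementResidual_le s H
  have hTs : ∀ g : G, IsPiNumber s (orderOf g) → g ∈ normalizer (T : Set G) := by
    intro g hg
    rw [hTE]
    exact (hH.sup_normal M).mem_normalizer_elementResidual hK hs hME hX hSN hg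
  have hET : E ≤ normalizer (T : Set G) := by
    rw [hTE]
    exact le_normalizer.trans (normalizer_le_normalizer_elementResidual s E)
  have hIs : ∀ g : G, IsPiNumber sᶜ (orderOf g) → g ∈ normalizer ((H ⊓ M : Subgroup G) : Set G) :=
    fun g hg => hH.mem_normalizer hK M hs (hi.of_dvd (relIndex_dvd_of_le_left M hCH)) hg
  have hMT : ∀ m ∈ M, ∀ t ∈ T, m * t * m⁻¹ * t⁻¹ ∈ H ⊓ M := by
    intro m hm t ht
    refine ⟨hTH (T.mul_mem ?_ (T.inv_mem ht)), ?_⟩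
    · exact le_normalizer_iff.mp hET m (hME hm) t ht
    · have := M.mul_mem hm (‹M.Normal›.conj_mem m⁻¹ (M.inv_mem hm) t)
      simpa [mul_assoc] using this
  -- To reach the core, every conjugate of the commutator must lie in H. Write g = wy: conjugation
  -- by y preserves M and T, and conjugation by w preserves H ∩ M.
  have hMTC : ∀ m ∈ M, ∀ t ∈ T, m * t * m⁻¹ * t⁻¹ ∈ C := by
    intro m hm t ht g
    obtain ⟨w, hw, y, hy, rfl⟩ := exists_mul_of_normalizer s hIs hTs g
    have h1 := hMT (y * m * y⁻¹) (‹M.Normal›.conj_mem m hm y) (y * t * y⁻¹)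
      ((mem_normalizer_iff.mp hy t).mp ht)
    have h2 := ((mem_normalizer_iff.mp hw _).mp h1).1
    have e : w * y * (m * t * m⁻¹ * t⁻¹) * (w * y)⁻¹ =
        w * (y * m * y⁻¹ * (y * t * y⁻¹) * (y * m * y⁻¹)⁻¹ * (y * t * y⁻¹)⁻¹) * w⁻¹ := by group
    rw [e]; exact h2
  set D := normalClosure (T : Set G)
  have hTD : T ≤ D := le_normalClosure
  have hDY : D ≤ Y := normalClosure_le_normal (hTH.trans hHY)
  -- The centralizer of M/C is normal in G, so it contains T^G once it contains T.
  have hDM : ∀ m ∈ M, ∀ d ∈ D, m * d * m⁻¹ * d⁻¹ ∈ C := by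
    have hn : (M.map (QuotientGroup.mk' C)).Normal :=
      ‹M.Normal›.map _ (QuotientGroup.mk'_surjective C)
    have key : ∀ d : G, d ∈ (centralizer (M.map (QuotientGroup.mk' C) : Set (G ⧸ C))).comap
        (QuotientGroup.mk' C) ↔ ∀ m ∈ M, m * d * m⁻¹ * d⁻¹ ∈ C := by
      intro d
      rw [mem_comap, mem_centralizer_iff]
      simp only [SetLike.mem_coe, mem_map, forall_exists_index, and_imp,
        forall_apply_eq_imp_iff₂]
      refine forall₂_congr fun m _ => ?_
      rw [← map_mul, ← map_mul, eq_comm, QuotientGroup.mk'_apply, QuotientGroup.mk'_apply,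
        QuotientGroup.eq, ← (show H.normalCore.Normal from inferInstance).mem_comm_iff]
      simp [mul_assoc, C]
    have hle : D ≤ (centralizer (M.map (QuotientGroup.mk' C) : Set (G ⧸ C))).comap
        (QuotientGroup.mk' C) :=
      normalClosure_le_normal fun t ht => (key t).mpr fun m hm => hMTC m hm t ht
    exact fun m hm d hd => (key d).mp (hle hd) m hm
  have hMX : M ≤ X := hME.trans hX
  have hDi : IsPiNumber sᶜ (M.relIndex D) := by
    obtain ⟨V, hV, hMV, hVX, h1, h2⟩ := hSN.exists_compl hK hMX hs
    have hTV : T ≤ V := (closure_le _).mpr fun g hg =>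
      mem_of_isPiNumber_relIndex hVX h2 (hX (hHE hg.1)) (le_normalizer_of_normal (mem_top g)) hg.2
    exact h1.of_dvd (relIndex_dvd_of_normal_left (normalClosure_le_normal hTV))
  have hDe : D ≤ elementResidual s D := by
    have := elementResidual_normal s D
    refine normalClosure_le_normal ?_
    exact (closure_le _).mpr fun g hg =>
      mem_elementResidual (hTD (mem_elementResidual hg.1 hg.2)) hg.2
  have hMDC : M ⊓ D ≤ C := inf_le_of_le_centralizer hCM hi hDi hDM hDe
  have hDC : IsSigmaNilpotentSection σ Y (D ⊔ C) := by
    have hidx : IsPiNumber s ((D ⊔ C).relIndex Y) := by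
      obtain ⟨A, hA, hMA, hAX, h1, h2⟩ := hSN s hs
      -- The index is an s-number because D contains O^s(H), and an s'-number because A induces the
      -- Hall s-subgroup of X/M. Hence Y/DC is covered by A, and A/C is an s-group.
      have hHA : H ≤ A ⊔ (D ⊔ C) := by
        rw [← relIndex_eq_one]
        refine IsPiNumber.eq_one (π := s) ?_ ?_
        · exact (isPiNumber_relIndex_elementResidual s H).of_dvd (relIndex_dvd_of_le_left H
            (hTD.trans (le_sup_left.trans le_sup_right)))
        · exact h2.of_dvd ((relIndex_dvd_of_normal_left (hHE.trans hX)).trans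
            (relIndex_dvd_of_le_left X le_sup_left))
      refine IsPiNumber.of_dvd ?_ (relIndex_dvd_of_normal_left (normalClosure_le_normal hHA))
      rw [relIndex_sup_right]
      refine IsPiNumber.of_dvd ?_ (relIndex_dvd_of_le_left A (le_sup_right : C ≤ D ⊔ C))
      rw [← relIndex_mul_relIndex C M A hCM hMA]
      exact hi.mul h1
    have hle : D ⊔ C ≤ Y := sup_le hDY (hCH.trans hHY)
    intro t ht
    by_cases hts : t = s
    · subst hts
      exact ⟨Y, inferInstance, hle, le_rfl, hidx, by rw [relIndex_self]; exact isPiNumber_one _⟩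
    · exact ⟨D ⊔ C, inferInstance, le_rfl, hle, by rw [relIndex_self]; exact isPiNumber_one _,
        hK.compl_of_ne ht hs (Ne.symm hts) hidx⟩
  have hfin : M ⊓ Y ⊓ (D ⊔ C) = C := by
    apply le_antisymm
    · rintro g ⟨⟨hgM, -⟩, hg⟩
      obtain ⟨d, hd, c, hc, rfl⟩ := mem_sup_of_normal_right.mp hg
      refine C.mul_mem (hMDC ⟨?_, hd⟩) hc
      have := M.mul_mem hgM (M.inv_mem (hCM hc))
      simpa using this
    · exact le_inf (le_inf hCM (hCH.trans hHY)) le_sup_right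
  rw [← hfin]
  exact (hSN.restrict hYX).inf hDC

end Minimal

/-- The normal closure of a permuting subgroup is `σ`-nilpotent modulo the core. -/
theorem Permutes.isSigmaNilpotentSection [Finite G] {σ : Set (Set ℕ)} {K : Set ℕ → Subgroup G}
    (hK : IsProjectorSystem σ K) {H : Subgroup G} (hH : Permutes σ K H) :
    IsSigmaNilpotentSection σ (normalClosure (H : Set G)) H.normalCore := by
  induction H using WellFoundedGT.induction with
  | ind H ih =>
    set C := H.normalCore with hC
    have hCH : C ≤ H := normalCore_le H
    by_cases hn : H.Normal
    · rw [hC, normalCore_eq_self, normalClosure_eq_self]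
      exact isSigmaNilpotentSection_self σ H
    have hCt : C ≠ ⊤ := by
      intro h
      apply hn
      have : H = ⊤ := top_le_iff.mp (h ▸ hCH)
      rw [this]
      infer_instance
    obtain ⟨N, -, hN⟩ :=
      (Set.toFinite {N : Subgroup G | N.Normal ∧ C ≤ N ∧ N ≠ C}).exists_le_minimal
      (a := ⊤) ⟨inferInstance, le_top, hCt.symm⟩
    obtain ⟨hNn, hCN, hNC⟩ := hN.prop
    have hNH : ¬ N ≤ H := fun h => hNC (le_antisymm (normal_le_normalCore.mpr h) hCN)
    have hmin : ∀ R : Subgroup G, R.Normal → C ≤ R → R ≤ N → R = C ∨ R = N := by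
      intro R hR hCR hRN
      by_cases h : R = C
      · exact Or.inl h
      · exact Or.inr (le_antisymm hRN (hN.le_of_le ⟨hR, hCR, h⟩ hRN))
    have hlt : H < H ⊔ N := lt_of_le_of_ne le_sup_left fun h => hNH (h ▸ le_sup_right)
    have hSN := ih (H ⊔ N) hlt (hH.sup_normal N)
    set M := (H ⊔ N).normalCore
    have hNM : N ≤ M := normal_le_normalCore.mpr le_sup_right
    have hME : M ≤ H ⊔ N := normalCore_le _
    have hHM : H ⊔ M = H ⊔ N := le_antisymm (sup_le le_sup_left hME) (sup_le_sup_left hNM H)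
    have hX : H ⊔ N ≤ normalClosure ((H ⊔ N : Subgroup G) : Set G) := le_normalClosure
    set Y := normalClosure (H : Set G)
    have hYX : Y ≤ normalClosure ((H ⊔ N : Subgroup G) : Set G) :=
      normalClosure_le_normal (show H ≤ _ from le_sup_left.trans hX)
    rcases hH.inf_normalClosure_le_or hK N hNH hCN hmin with h | ⟨s, hs, hi⟩
    -- By Dedekind, M ∩ Y ≤ HN ∩ Y = H(N ∩ Y) ≤ H.
    · have hMY : M ⊓ Y = C := by
        apply le_antisymm
        · refine normal_le_normalCore.mpr ?_
          rintro g ⟨hgM, hgY⟩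
          obtain ⟨x, hx, n, hn, rfl⟩ := mem_sup_of_normal_right.mp (hME hgM)
          refine H.mul_mem hx (hCH (h ⟨hn, ?_⟩))
          have := mul_mem (Y.inv_mem (le_normalClosure hx)) hgY
          simpa using this
        · exact le_inf (hCN.trans hNM) (hCH.trans le_normalClosure)
      rw [← hMY]
      exact hSN.restrict hYX
    · have h1 : IsPiNumber s (H.relIndex M) := by
        rw [← relIndex_sup_normal, hHM, relIndex_sup_normal]
        exact hi.of_dvd (relIndex_dvd_of_le_left N hCH)
      exact hH.isSigmaNilpotentSection_of_isPiNumber hK hs (hCN.trans hNM)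
        (hH.isPiNumber_core_relIndex hK hs M h1) (hHM.le.trans hX) hSN

-- Existence of projectors for the class of π-groups.

universe u

theorem card_map_mk' {G : Type*} [Group G] (N K : Subgroup G) [N.Normal] :
    Nat.card (K.map (QuotientGroup.mk' N)) = N.relIndex K := by
  rw [← relIndex_ker, QuotientGroup.ker_mk']

/-- This moves the maximality in quotients to subgroups of G, so that the existence proof can change
N without changing the ambient type. -/
theorem isPiProjector_iff {G : Type*} [Group G] {π : Set ℕ} {K : Subgroup G} :
    IsPiProjector π K ↔ IsPiGroup π K ∧ ∀ N U : Subgroup G, N.Normal → K ≤ U → N ≤ U →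
      IsPiNumber π (N.relIndex U) → U ≤ K ⊔ N := by
  constructor
  · refine fun h => ⟨?_, ?_⟩
    · have := (h ⊥).prop
      rwa [IsPiGroup, card_map_mk', relIndex_bot_left] at this
    · intro N U hN hKU hNU hi
      have h1 := (h N).le_of_ge (y := U.map (QuotientGroup.mk' N))
        (by rwa [IsPiGroup, card_map_mk']) (map_mono hKU)
      rw [map_le_iff_le_comap, QuotientGroup.comap_map_mk'] at h1
      rwa [sup_comm]
  · rintro ⟨hc, h⟩ N hN
    refine ⟨?_, fun L hL hKL => ?_⟩
    · show IsPiNumber π (Nat.card _)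
      rw [card_map_mk']
      exact IsPiNumber.of_dvd hc (relIndex_dvd_card _ _)
    · have hLe : (L.comap (QuotientGroup.mk' N)).map (QuotientGroup.mk' N) = L :=
        map_comap_eq_self_of_surjective (QuotientGroup.mk'_surjective N) L
      have hi : IsPiNumber π (N.relIndex (L.comap (QuotientGroup.mk' N))) := by
        rw [← card_map_mk', hLe]; exact hL
      have h1 := h N (L.comap (QuotientGroup.mk' N)) hN (map_le_iff_le_comap.mp hKL)
        (QuotientGroup.le_comap_mk' N L) hi
      rw [← hLe, map_le_iff_le_comap, QuotientGroup.comap_map_mk', sup_comm]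
      exact h1

/-- If O/N is a π-group, then so is KO/N, which contains KN/N. If K ≤ N, the trivial subgroup is a
maximal π-subgroup of G/N, so Cauchy's theorem excludes primes of π from |G : N|. -/
theorem IsPiProjector.isNormalProjector {G : Type*} [Group G] [Finite G] {π : Set ℕ}
    {K : Subgroup G} (h : IsPiProjector π K) : IsNormalProjector π K := by
  obtain ⟨hc, h⟩ := isPiProjector_iff.mp h
  refine ⟨hc, ?_, ?_⟩
  · intro N O hN hO hNO hi
    refine le_sup_right.trans (h N (K ⊔ O) hN le_sup_left (hNO.trans le_sup_right) ?_)
    rw [← relIndex_mul_relIndex N O (K ⊔ O) hNO le_sup_right, relIndex_sup_right]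
    exact hi.mul (IsPiNumber.of_dvd hc (relIndex_dvd_card _ _))
  · intro N hN hKN p hp hpN hpπ
    have := Fact.mk hp
    obtain ⟨q, hq⟩ := exists_prime_orderOf_dvd_card' (G := G ⧸ N) p hpN
    obtain ⟨g, rfl⟩ := QuotientGroup.mk'_surjective N q
    have hle : (zpowers g).map (QuotientGroup.mk' N) = zpowers (QuotientGroup.mk' N g) :=
      MonoidHom.map_zpowers _ _
    have h1 := h N (N ⊔ zpowers g) hN (hKN.trans le_sup_left) le_sup_left (by
      rw [relIndex_sup_left, ← card_map_mk', hle, Nat.card_zpowers, hq]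
      intro r hr hrp
      rwa [(Nat.prime_dvd_prime_iff_eq hr hp).mp hrp])
    rw [sup_eq_right.mpr hKN] at h1
    have h2 : g ∈ N := h1 (mem_sup_right (mem_zpowers g))
    have h3 : QuotientGroup.mk' N g = 1 := (QuotientGroup.eq_one_iff g).mpr h2
    rw [h3, orderOf_one] at hq
    exact hp.ne_one hq.symm

/-- A minimal supplement of a normal subgroup of `π`-index is a `π`-group. -/
theorem exists_isPiGroup_sup_eq_top {G : Type*} [Group G] [Finite G] {π : Set ℕ} (N : Subgroup G)
    [N.Normal] (hN : IsPiNumber π N.index) : ∃ S : Subgroup G, IsPiGroup π S ∧ S ⊔ N = ⊤ := by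
  obtain ⟨S, -, hS⟩ := (Set.toFinite {S : Subgroup G | S ⊔ N = ⊤}).exists_le_minimal (a := ⊤)
    (by simp)
  refine ⟨S, ?_, hS.prop⟩
  -- By minimality of S, the intersection N ∩ S has no proper supplement in S.
  have hmin : ∀ R : Subgroup S, R ⊔ N.subgroupOf S = ⊤ → R = ⊤ := by
    intro R hR
    have h1 : R.map S.subtype ⊔ N = ⊤ := by
      rw [eq_top_iff, ← show S ⊔ N = ⊤ from hS.prop]
      refine sup_le ?_ le_sup_right
      have h2 := congrArg (Subgroup.map S.subtype) hR
      rw [Subgroup.map_sup, subgroupOf_map_subtype, ← MonoidHom.range_eq_map, range_subtype] at h2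
      exact h2.ge.trans (sup_le_sup_left inf_le_left _)
    have h3 := hS.le_of_le h1 (map_subtype_le R)
    rw [eq_top_iff]
    rintro ⟨x, hx⟩ -
    obtain ⟨y, hy, hyx⟩ := h3 hx
    have : y = ⟨x, hx⟩ := Subtype.ext hyx
    rwa [← this]
  intro p hp hpS
  by_contra hpπ
  have := Fact.mk hp
  obtain ⟨P⟩ : Nonempty (Sylow p S) := inferInstance
  have hDi : IsPiNumber π (N.subgroupOf S).index :=
    hN.of_dvd (relIndex_dvd_index_of_normal N S)
  have hPD : (P : Subgroup S) ≤ N.subgroupOf S := by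
    intro x hx
    refine mem_of_isPiNumber_index hDi ?_
    obtain ⟨k, hk⟩ := P.isPGroup' ⟨x, hx⟩
    have hk' : x ^ p ^ k = 1 := by
      simpa using congrArg (fun y : P => (y : S)) hk
    intro q hq hqd
    rwa [(Nat.prime_dvd_prime_iff_eq hq hp).mp
      (hq.dvd_of_dvd_pow (hqd.trans (orderOf_dvd_of_pow_eq_one hk')))]
  -- The Frattini argument makes the normalizer of P a supplement of N ∩ S. A complement of P is
  -- then one too, so it is all of S, which forces P = 1.
  have hPn : (P : Subgroup S).Normal :=
    normalizer_eq_top_iff.mp (hmin _ (P.normalizer_sup_eq_top' hPD))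
  obtain ⟨U, hU⟩ := exists_right_complement'_of_coprime P.card_coprime_index
  have hUt : U = ⊤ := hmin U (top_le_iff.mp (by
    rw [← hU.sup_eq_top, sup_comm]; exact sup_le_sup_left hPD U))
  have hd := hU.disjoint
  rw [hUt, disjoint_top] at hd
  have h1 := P.dvd_card_of_dvd_card hpS
  rw [← SetLike.coe_sort_coe] at h1
  have h2 : Nat.card (P : Subgroup S) = 1 := by rw [hd]; exact card_bot
  exact hp.ne_one (Nat.dvd_one.mp (h2 ▸ h1))

theorem exists_isPiProjector (π : Set ℕ) (G : Type u) [Group G] [Finite G] :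
    ∃ K : Subgroup G, IsPiProjector π K := by
  induction hn : Nat.card G using Nat.strong_induction_on generalizing G with
  | _ n ih =>
  simp only [isPiProjector_iff] at ih ⊢
  by_cases hG : IsPiNumber π (Nat.card G)
  · exact ⟨⊤, by rwa [IsPiGroup, card_top], fun N U _ _ _ _ => le_top.trans le_sup_left⟩
  have hbt : (⊤ : Subgroup G) ≠ ⊥ := by
    intro h
    apply hG
    rw [← card_top, h, card_bot]
    exact isPiNumber_one π
  obtain ⟨N, -, hN⟩ := (Set.toFinite {N : Subgroup G | N.Normal ∧ N ≠ ⊥}).exists_le_minimal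
    (a := ⊤) ⟨inferInstance, hbt⟩
  obtain ⟨hNn, hNb⟩ := hN.prop
  have hcard : Nat.card (G ⧸ N) < n := by
    rw [← hn, ← card_mul_index N, ← index_eq_card]
    have h1 : 1 < Nat.card N := (one_lt_card_iff_ne_bot N).mpr hNb
    have h2 : 0 < N.index := Nat.pos_of_ne_zero index_ne_zero_of_finite
    nlinarith
  obtain ⟨Q, hQc, hQ⟩ := ih _ hcard (G ⧸ N) rfl
  have hf := QuotientGroup.mk'_surjective N
  set L := Q.comap (QuotientGroup.mk' N)
  have hLQ : L.map (QuotientGroup.mk' N) = Q := map_comap_eq_self_of_surjective hf Q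
  have hNL : N ≤ L := QuotientGroup.le_comap_mk' N Q
  have hLi : IsPiNumber π (N.relIndex L) := by rw [← card_map_mk', hLQ]; exact hQc
  by_cases hL : L = ⊤
  · obtain ⟨S, hS, hSN⟩ := exists_isPiGroup_sup_eq_top N (π := π)
      (by rwa [hL, relIndex_top_right] at hLi)
    obtain ⟨K, hSK, hK⟩ :=
      (Set.toFinite {K : Subgroup G | IsPiGroup π K}).exists_le_maximal (a := S) hS
    refine ⟨K, hK.prop, fun M U hM hKU hMU hi => ?_⟩
    have hKN : K ⊔ N = ⊤ := top_le_iff.mp (hSN ▸ sup_le_sup_right hSK N)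
    by_cases hNM : N ≤ M
    · have : K ⊔ M = ⊤ := top_le_iff.mp (hKN ▸ sup_le_sup_left hNM K)
      rw [this]; exact le_top
    -- Here M embeds in the π-group G/N, so U is itself a π-group and maximality of K applies.
    · have hMN : N ⊓ M = ⊥ := by
        by_contra hb
        exact hNM ((hN.le_of_le (y := N ⊓ M) ⟨inferInstance, hb⟩ inf_le_left).trans inf_le_right)
      have hMc : IsPiNumber π (Nat.card M) := by
        rw [← relIndex_bot_left, ← hMN, inf_relIndex_right]
        refine hLi.of_dvd ?_
        rw [hL]
        exact relIndex_dvd_of_normal_left le_top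
      refine le_sup_of_le_left (hK.le_of_ge (y := U) ?_ hKU)
      show IsPiNumber π (Nat.card U)
      rw [← relIndex_bot_left, ← relIndex_mul_relIndex ⊥ M U bot_le hMU, relIndex_bot_left]
      exact hMc.mul hi
  · have hLc : Nat.card L < n := by
      rw [← hn]
      refine lt_of_le_of_ne (card_le_card_group L) fun h => hL (eq_top_of_card_eq L h)
    obtain ⟨K, hKc, hK⟩ := ih _ hLc L rfl
    have hKL : K.map L.subtype ≤ L := map_subtype_le K
    have hLK : L ≤ K.map L.subtype ⊔ N := by
      have h1 := hK (N.subgroupOf L) ⊤ inferInstance le_top le_top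
        (by rw [relIndex_top_right]; exact hLi)
      have h2 := map_mono (f := L.subtype) h1
      rw [Subgroup.map_sup, subgroupOf_map_subtype, ← MonoidHom.range_eq_map, range_subtype] at h2
      exact h2.trans (sup_le_sup_left inf_le_left _)
    refine ⟨K.map L.subtype, ?_, fun M U hM hKU hMU hi => ?_⟩
    · rw [IsPiGroup, card_map_of_injective L.subtype_injective]; exact hKc
    -- The classical transfer: L/N is a projector of G/N and K is one of L. Since KN = L, the image
    -- of U contains Q, and the projector property of Q bounds U; that of K then handles U ∩ L.
    have hUL : U ≤ L ⊔ M := by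
      have hMn : (M.map (QuotientGroup.mk' N)).Normal := hM.map _ hf
      have h1 := hQ (M.map (QuotientGroup.mk' N)) (U.map (QuotientGroup.mk' N)) hMn ?_
        (map_mono hMU) ?_
      · rw [← hLQ, ← Subgroup.map_sup, map_le_iff_le_comap, QuotientGroup.comap_map_mk'] at h1
        exact h1.trans (sup_le (hNL.trans le_sup_left) le_rfl)
      · rw [← hLQ, map_le_iff_le_comap, QuotientGroup.comap_map_mk']
        exact hLK.trans (sup_le (hKU.trans le_sup_right) le_sup_left)
      · rw [relIndex_map_map, QuotientGroup.ker_mk']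
        have e : U ⊔ N = U ⊔ (M ⊔ N) := by rw [← sup_assoc, sup_eq_left.mpr hMU]
        rw [e, relIndex_sup_right]
        exact hi.of_dvd (relIndex_dvd_of_le_left U le_sup_left)
    have h1 := hK (M.subgroupOf L) (U.subgroupOf L) inferInstance
      (fun x hx => hKU (mem_map_of_mem L.subtype hx)) (comap_mono hMU) (by
        rw [subgroupOf, relIndex_comap, subgroupOf_map_subtype]
        exact hi.of_dvd (relIndex_dvd_of_normal_left inf_le_left))
    have h2 := map_mono (f := L.subtype) h1
    rw [Subgroup.map_sup, subgroupOf_map_subtype, subgroupOf_map_subtype] at h2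
    intro x hx
    obtain ⟨l, hl, m, hm, rfl⟩ := mem_sup_of_normal_right.mp (hUL hx)
    have hlU : l ∈ U := by
      have := U.mul_mem hx (U.inv_mem (hMU hm))
      simpa using this
    have hle : K.map L.subtype ⊔ M ⊓ L ≤ K.map L.subtype ⊔ M := sup_le_sup_left inf_le_left _
    exact mul_mem (hle (h2 ⟨hlU, hl⟩)) (mem_sup_right hm)

/-! ### Translation to quotient groups, and the converse direction. -/

section Translation

theorem card_map_section {X C : Subgroup G} [C.Normal] (A : Subgroup G) (hA : A ≤ X) :
    Nat.card ((A.subgroupOf X).map (QuotientGroup.mk' (C.subgroupOf X))) = C.relIndex A := by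
  rw [card_map_mk', subgroupOf, relIndex_comap, subgroupOf_map_subtype, inf_eq_left.mpr hA]

theorem IsSigmaNilpotentSection.isSigmaNilpotent {σ : Set (Set ℕ)} {X C : Subgroup G} [C.Normal]
    (h : IsSigmaNilpotentSection σ X C) : IsSigmaNilpotent σ (Section X C) := by
  intro s hs
  obtain ⟨A, hA, hCA, hAX, h1, h2⟩ := h s hs
  have hf := QuotientGroup.mk'_surjective (C.subgroupOf X)
  refine ⟨(A.subgroupOf X).map (QuotientGroup.mk' (C.subgroupOf X)),
    (inferInstance : (A.subgroupOf X).Normal).map _ hf, ?_, ?_⟩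
  · show IsPiNumber s (Nat.card _)
    rw [card_map_section A hAX]
    exact h1
  · rw [index_map_eq _ hf (by rw [QuotientGroup.ker_mk']; exact comap_mono hCA)]
    exact h2

/-- A normal Hall subgroup of X/C contains every s-subgroup of X/C. It therefore contains its own
conjugates under G, and its preimage is normal in G. -/
theorem IsSigmaNilpotent.isSigmaNilpotentSection [Finite G] {σ : Set (Set ℕ)} {X C : Subgroup G}
    [hC : C.Normal] [hX : X.Normal] (hCX : C ≤ X) (h : IsSigmaNilpotent σ (Section X C)) :
    IsSigmaNilpotentSection σ X C := by
  intro s hs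
  obtain ⟨K, hK, hKc, hKi⟩ := h s hs
  have hf := QuotientGroup.mk'_surjective (C.subgroupOf X)
  set B := K.comap (QuotientGroup.mk' (C.subgroupOf X)) with hB
  set A := B.map X.subtype
  have hAX : A ≤ X := map_subtype_le B
  have hBA : A.subgroupOf X = B := comap_map_eq_self_of_injective X.subtype_injective B
  have hCA : C ≤ A := by
    intro c hc
    refine ⟨⟨c, hCX hc⟩, ?_, rfl⟩
    exact QuotientGroup.le_comap_mk' (C.subgroupOf X) K hc
  have hKB : B.map (QuotientGroup.mk' (C.subgroupOf X)) = K :=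
    map_comap_eq_self_of_surjective hf K
  have h1 : IsPiNumber s (C.relIndex A) := by
    rw [← card_map_section A hAX, hBA, hKB]; exact hKc
  have h2 : IsPiNumber sᶜ (A.relIndex X) := by
    rw [relIndex, hBA, hB, index_comap_of_surjective _ hf]; exact hKi
  have hXA : X ≤ normalizer (A : Set G) := by
    have : (A.subgroupOf X).Normal := by rw [hBA]; exact hK.comap _
    exact le_normalizer_of_normal_subgroupOf hAX
  refine ⟨A, ?_, hCA, hAX, h1, h2⟩
  rw [← normalizer_eq_top_iff, eq_top_iff]
  intro g _
  refine mem_normalizer_of_conjSubgroup_le ?_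
  have hgX : conjSubgroup A g ≤ X := conjSubgroup_le_iff.mpr hAX
  have hgC : conjSubgroup C g = C := Normal.map_conj_eq C g⁻¹
  rw [← relIndex_eq_one]
  refine IsPiNumber.eq_one (π := s) ?_ ?_
  · refine IsPiNumber.of_dvd ?_ (relIndex_dvd_of_le_left _ hCA)
    have : C.relIndex (conjSubgroup A g) = C.relIndex A := by
      conv_lhs => rw [← hgC]
      exact relIndex_map_map_of_injective C A (MulAut.conj g⁻¹).injective
    rwa [this]
  · refine h2.of_dvd ?_
    rw [← relIndex_sup_of_mul_comm (mul_comm_of_le_normalizer (hgX.trans hXA))]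
    exact relIndex_dvd_relIndex_of_le_right le_sup_left (sup_le hAX hgX)

/-- (H ∩ A)/C is a normal Hall s-subgroup of H/C, hence equal to its s-core. -/
theorem coreSectionPreimage_eq {s : Set ℕ} {H A : Subgroup G} [A.Normal]
    (hCA : H.normalCore ≤ A) (h1 : IsPiNumber s (H.normalCore.relIndex A))
    (h2 : IsPiNumber sᶜ (A.relIndex H)) : coreSectionPreimage s H = H ⊓ A := by
  set C := H.normalCore
  have hf := QuotientGroup.mk'_surjective (C.subgroupOf H)
  have hCA' : C.subgroupOf H ≤ A.subgroupOf H := comap_mono hCA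
  have hcore : piCore s (Section H C) =
      (A.subgroupOf H).map (QuotientGroup.mk' (C.subgroupOf H)) := by
    apply le_antisymm
    · refine sSup_le ?_
      rintro N ⟨hN, hNc⟩
      have hNe : (N.comap (QuotientGroup.mk' (C.subgroupOf H))).map
          (QuotientGroup.mk' (C.subgroupOf H)) = N := map_comap_eq_self_of_surjective hf N
      rw [← hNe]
      refine map_mono ?_
      rw [← relIndex_eq_one]
      refine IsPiNumber.eq_one (π := s) ?_ ?_
      · refine IsPiNumber.of_dvd ?_ (relIndex_dvd_of_le_left _ hCA')
        rw [← card_map_mk', hNe]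
        exact hNc
      · exact h2.of_dvd (relIndex_dvd_index_of_normal _ _)
    · refine le_sSup ⟨(inferInstance : (A.subgroupOf H).Normal).map _ hf, ?_⟩
      show IsPiNumber s (Nat.card _)
      rw [card_map_mk', subgroupOf, relIndex_comap, subgroupOf_map_subtype]
      exact h1.of_dvd (relIndex_dvd_of_normal_left inf_le_left)
  rw [coreSectionPreimage, hcore, QuotientGroup.comap_map_mk', sup_eq_right.mpr hCA',
    subgroupOf_map_subtype, inf_comm]

theorem conjClosure_eq_self_iff {X Y : Subgroup G} :
    conjClosure X Y = X ↔ Y ≤ normalizer (X : Set G) := by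
  rw [le_normalizer_iff]
  constructor
  · intro h y hy x hx
    rw [← h]
    exact subset_closure ⟨x, hx, y⁻¹, Y.inv_mem hy, by simp⟩
  · intro h
    refine le_antisymm ((closure_le _).mpr ?_) fun x hx =>
      subset_closure ⟨x, hx, 1, Y.one_mem, by simp⟩
    rintro g ⟨x, hx, y, hy, rfl⟩
    simpa using h y⁻¹ (Y.inv_mem hy) x hx

theorem mem_piResidual {s : Set ℕ} {g : G} (hg : IsPiNumber sᶜ (orderOf g)) :
    g ∈ piResidual s G := by
  rw [piResidual, mem_sInf]
  rintro N ⟨hN, hi⟩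
  exact mem_of_isPiNumber_index hi hg

theorem piResidual_le_elementResidual [Finite G] (s : Set ℕ) :
    piResidual s G ≤ elementResidual s (⊤ : Subgroup G) := by
  refine sInf_le ⟨elementResidual_normal s ⊤, ?_⟩
  rw [← relIndex_top_right]
  exact isPiNumber_relIndex_elementResidual s ⊤

/-- If every `H ⊓ A t` is normalized by the elements of order prime to `t`, where `A t` induces the
Hall `t`-subgroup of `H^G / H_G`, then `H` permutes with the family. -/
theorem permutes_of_normalizer [Finite G] {σ : Set (Set ℕ)} {K : Set ℕ → Subgroup G}
    (hK : IsProjectorSystem σ K) {H : Subgroup G} (A : Set ℕ → Subgroup G)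
    (hA : ∀ t ∈ σ, (A t).Normal) (hCA : ∀ t ∈ σ, H.normalCore ≤ A t)
    (h1 : ∀ t ∈ σ, IsPiNumber t (H.normalCore.relIndex (A t)))
    (h2 : ∀ t ∈ σ, IsPiNumber tᶜ ((A t).relIndex H))
    (hn : ∀ t ∈ σ, ∀ g : G, IsPiNumber tᶜ (orderOf g) →
      g ∈ normalizer ((H ⊓ A t : Subgroup G) : Set G)) : Permutes σ K H := by
  intro s hs x
  have hL := (hK.projector s hs).conj x
  set L := conjSubgroup (K s) x
  set C := H.normalCore
  have hCH : C ≤ H := normalCore_le H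
  set S : Set G := {g | g ∈ H ∧ ∃ t ∈ σ, t ≠ s ∧ g ∈ A t}
  have hSH : closure S ≤ H := (closure_le _).mpr fun g hg => hg.1
  have hLS : L ≤ normalizer (closure S : Set G) := by
    refine le_trans ?_ (normalizer_le_normalizer_closure S)
    rw [le_set_normalizer_iff]
    rintro l hl g ⟨hgH, t, ht, hts, hgA⟩
    have := (mem_normalizer_iff.mp (hn t ht l (hK.compl_of_ne ht hs hts.symm
      (isPiNumber_orderOf hL.isPiGroup hl))) g).mp ⟨hgH, hgA⟩
    exact ⟨this.1, t, ht, hts, this.2⟩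
  have hHS : H ≤ normalizer (closure S : Set G) := by
    refine le_trans ?_ (normalizer_le_normalizer_closure S)
    rw [le_set_normalizer_iff]
    rintro y hy g ⟨hgH, t, ht, hts, hgA⟩
    exact ⟨mul_mem (mul_mem hy hgH) (H.inv_mem hy), t, ht, hts, (hA t ht).conj_mem g hgA y⟩
  have hgen : H ≤ closure S ⊔ (H ⊓ A s) := by
    rw [← relIndex_eq_one]
    refine hK.eq_one_of_forall (relIndex_dvd_natCard _ _) fun t ht => ?_
    have hle : A t ⊓ H ≤ closure S ⊔ (H ⊓ A s) := by
      by_cases hts : t = s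
      · subst hts; rw [inf_comm]; exact le_sup_right
      · exact le_sup_of_le_left fun g hg => subset_closure ⟨hg.2, t, ht, hts, hg.1⟩
    refine IsPiNumber.of_dvd ?_ (relIndex_dvd_of_le_left H hle)
    rw [inf_relIndex_right]
    exact h2 t ht
  -- H = B(H ∩ A_s) with B = `closure S`. The projector conjugate L normalizes B, and A_s ≤ LC, so
  -- each factor can be moved past L at the cost of elements of H.
  have hprod := coe_sup_of_mul_comm
    (mul_comm_of_le_normalizer (H := closure S) (K := H ⊓ A s) (inf_le_left.trans hHS))
  refine mul_comm_of_forall ?_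
  intro k hk h hh
  have hh' : h ∈ ((closure S ⊔ (H ⊓ A s) : Subgroup G) : Set G) := hgen hh
  rw [hprod] at hh'
  obtain ⟨b, hb, a, ha, rfl⟩ := hh'
  obtain ⟨l, hl, c, hc, rfl⟩ := mem_sup_of_normal_right.mp
    (hL.le_sup C (A s) inferInstance (hA s hs) (hCA s hs) (h1 s hs) ha.2)
  refine ⟨k * b * k⁻¹ * (k * l * c * (k * l)⁻¹), ?_, k * l, L.mul_mem hk hl, by simp [mul_assoc]⟩
  refine H.mul_mem (hSH (le_normalizer_iff.mp hLS k hk b hb)) (hCH ?_)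
  exact H.normalCore_normal.conj_mem c hc (k * l)

end Translation

theorem isSigmaPPermutable_iff {G : Type*} [Group G] [Finite G] (P : Set ℕ) (σ : Set (Set ℕ))
    (hG : primeDivisors G ⊆ P) (hσ : IsPartitionOf σ P) (H : Subgroup G) :
    IsSigmaPPermutable σ H ↔
      IsSigmaNilpotent σ (Section (normalClosure (H : Set G)) H.normalCore) ∧
        ∀ s ∈ σ, (s ∩ primeDivisors (Section H H.normalCore)).Nonempty →
          conjClosure (coreSectionPreimage s H) (piResidual s G) = coreSectionPreimage s H := by
  obtain ⟨-, hdisj, hcov⟩ := hσ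
  have hmem : ∀ p : ℕ, p.Prime → p ∣ Nat.card G → ∃ s ∈ σ, p ∈ s := by
    intro p hp hpG
    have : p ∈ ⋃₀ σ := by rw [hcov]; exact hG ⟨hp, hpG⟩
    exact this
  have hHX : H ≤ normalClosure (H : Set G) := le_normalClosure
  constructor
  · intro h
    choose! K hKproj hKperm using h
    have hK : IsProjectorSystem σ K :=
      ⟨hmem, hdisj, fun s hs => (hKproj s hs).isNormalProjector⟩
    have hH : Permutes σ K H := hKperm
    have hSN := hH.isSigmaNilpotentSection hK
    refine ⟨hSN.isSigmaNilpotent, fun s hs _ => ?_⟩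
    obtain ⟨A, hA, hCA, hAX, h1, h2⟩ := hSN s hs
    rw [coreSectionPreimage_eq hCA h1 (h2.of_dvd (relIndex_dvd_of_normal_left hHX)),
      conjClosure_eq_self_iff]
    refine (piResidual_le_elementResidual s).trans ((closure_le _).mpr fun g hg => ?_)
    exact hH.mem_normalizer hK A hs (h1.of_dvd (relIndex_dvd_of_le_left A (normalCore_le H))) hg.2
  · rintro ⟨hnil, hcond⟩
    choose K hKproj using fun s : Set ℕ => exists_isPiProjector s G
    have hK : IsProjectorSystem σ K := ⟨hmem, hdisj, fun s _ => (hKproj s).isNormalProjector⟩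
    have hSN := hnil.isSigmaNilpotentSection ((normalCore_le H).trans hHX)
    choose! A hA hCA hAX h1 h2 using hSN
    have h2' : ∀ t ∈ σ, IsPiNumber tᶜ ((A t).relIndex H) := fun t ht => by
      have := hA t ht
      exact (h2 t ht).of_dvd (relIndex_dvd_of_normal_left hHX)
    suffices hH : Permutes σ K H from fun s hs => ⟨K s, hKproj s, hH s hs⟩
    refine permutes_of_normalizer hK A hA hCA h1 h2' fun t ht g hg => ?_
    have := hA t ht
    by_cases hne : (t ∩ primeDivisors (Section H H.normalCore)).Nonempty
    · have h3 := hcond t ht hne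
      rw [coreSectionPreimage_eq (hCA t ht) (h1 t ht) (h2' t ht), conjClosure_eq_self_iff] at h3
      exact h3 (mem_piResidual hg)
    -- Condition 2 says nothing about such t, but then H ∩ A_t is the core itself, which is
    -- normalized by everything.
    · have h3 : H ⊓ A t ≤ H.normalCore := by
        rw [← relIndex_eq_one]
        by_contra hne1
        obtain ⟨p, hp, hpd⟩ := Nat.exists_prime_and_dvd hne1
        refine hne ⟨p, h1 t ht p hp (hpd.trans (relIndex_dvd_of_normal_left inf_le_right)), hp, ?_⟩
        exact hpd.trans (relIndex_dvd_of_normal_left inf_le_left)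
      have h4 : H ⊓ A t = H.normalCore :=
        le_antisymm h3 (le_inf (normalCore_le H) (hCA t ht))
      rw [h4, normalizer_eq_top]
      trivial

end SigmaGroup

theorem theorem6 {G : Type*} [Group G] [Finite G] (P : Set ℕ) (σ : Set (Set ℕ))
    (hP : ∀ p ∈ P, p.Prime) (hG : SigmaGroup.primeDivisors G ⊆ P)
    (hσ : SigmaGroup.IsPartitionOf σ P) (H : Subgroup G) :
    SigmaGroup.IsSigmaPPermutable σ H ↔
      SigmaGroup.IsSigmaNilpotent σ
          (SigmaGroup.Section (Subgroup.normalClosure (H : Set G)) H.normalCore) ∧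
        ∀ s ∈ σ, (s ∩ SigmaGroup.primeDivisors (SigmaGroup.Section H H.normalCore)).Nonempty →
          SigmaGroup.conjClosure (SigmaGroup.coreSectionPreimage s H) (SigmaGroup.piResidual s G) =
            SigmaGroup.coreSectionPreimage s H := by
  exact SigmaGroup.isSigmaPPermutable_iff P σ hG hσ H
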